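/- Let $A\in\mathbb R^{n\times n}$, $B\in\mathbb R^{n\times m}$, let $Q\in\mathbb R^{n\times n}$ be symmetric and let $\mathcal L\subset\mathbb R^n$ be a subspace. For symmetric $K$ put $\phi(K)=A^\top K+KA+Q-KBB^\top K$, and let $\Gamma_-$ be the set of symmetric $K\le 0$ with $\phi(K)\ge 0$. Assume that $(A,B)$ is stabilizable and that $\Gamma_-\neq\emptyset$. For a real square matrix $M$ with characteristic polynomial $p=p_-p_0p_+$, where $p_-,p_0,p_+$ are real monic polynomials with all roots in $\operatorname{Re}z<0$, $\operatorname{Re}z=0$, $\operatorname{Re}z>0$ respectively, put $\mathcal X^{-}(M)=\ker p_-(M)$, $\mathcal X^{0}(M)=\ker p_0(M)$, $\mathcal X^{+}(M)=\ker p_+(M)$. For a subspace $\mathcal V\subset\mathbb R^k$ and $M\in\mathbb R^{k\times k}$ put $\langle\mathcal V\mid M\rangle=\{x: M^ix\in\mathcal V,\ 0\le i<k\}$. Choose coordinates of $\mathbb R^n$ (an invertible matrix $T$ whose columns are the new basis vectors) such that the first $n_1$ basis vectors span the controllable subspace $\mathcal C=\operatorname{Im}B+A\operatorname{Im}B+\dots+A^{n-1}\operatorname{Im}B$;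 the remaining ones span an arbitrary complement $\mathcal X_2$ of $\mathcal C$. Let $A_1$ and $Q_1$ be the upper left $n_1\times n_1$ blocks of $T^{-1}AT$ and $T^\top QT$, let $B_1$ consist of the first $n_1$ rows of $T^{-1}B$, and let $\mathcal L_1\subset\mathbb R^{n_1}$ be $\mathcal L\cap\mathcal C$ in these coordinates. Put $\partial\Gamma_1=\{K_1=K_1^\top: A_1^\top K_1+K_1A_1+Q_1-K_1B_1B_1^\top K_1=0\}$ and $A_1(K_1)=A_1-B_1B_1^\top K_1$. Then $\partial\Gamma_1$ has a minimal (least) element $K_1^-$ and a maximal (greatest) element $K_1^+$ in the semidefinite order. With $\Delta_1=K_1^+-K_1^-$ and $$\mathcal N_1=\langle\mathcal L_1\cap\ker K_1^-\mid A_1(K_1^-)\rangle\cap\mathcal X^+(A_1(K_1^-)),$$ one has $\mathbb R^{n_1}=\mathcal N_1\oplus\Delta_1^{-1}(\mathcal N_1^\perp)$, where $\Delta_1^{-1}(\mathcal N_1^\perp)=\{x:\Delta_1x\in\mathcal N_1^\perp\}$. Let $P$ be the projection onto $\mathcal N_1$ along $\Delta_1^{-1}(\mathcal N_1^\perp)$,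 let $\overline K_1=K_1^-P+K_1^+(I-P)$, and let $\mathcal X_{1,1}=\mathcal X^+(A_1(\overline K_1))$, $\mathcal X_{1,2}=\mathcal X^0(A_1(\overline K_1))$, $\mathcal X_{1,3}=\mathcal X^-(A_1(\overline K_1))$. Suppose that the coordinates are adapted to $\mathbb R^n=\mathcal X_{1,1}\oplus\mathcal X_{1,2}\oplus\mathcal X_{1,3}\oplus\mathcal X_2$, that is, the first $n_1$ coordinates are divided into three consecutive groups such that $\mathcal X_{1,i}$ is the span of the basis vectors of the $i$-th group, $i=1,2,3$. Then every $K_N\in\Gamma_-$, written in these coordinates (as $T^\top K_NT$), has the block form $$K_N=\begin{bmatrix}0&0&0&0\\0&K_{1,22}^-&K_{1,23}^-&K_{12,2}\\0&(K_{1,23}^-)^\top&K_{1,33}&K_{12,3}\\0&K_{12,2}^\top&K_{12,3}^\top&K_2\end{bmatrix},$$ where $K_{1,22}^-$ and $K_{1,23}^-$ are the $(2,2)$ and $(2,3)$ blocks of $K_1^-$ in the same coordinates, and $K_{1,33},K_{12,2},K_{12,3},K_2$ are some real matrices, depending on $K_N$. -/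

import Mathlib

namespace LQ

open Matrix Polynomial

variable {n m : Type*} [Fintype n] [DecidableEq n] [Fintype m]

/-- The Riccati map `φ(K) = AᵀK + KA + Q - KBBᵀK` (the input weight is the identity). -/
def riccati (A : Matrix n n ℝ) (B : Matrix n m ℝ) (Q K : Matrix n n ℝ) : Matrix n n ℝ :=
  Aᵀ * K + K * A + Q - K * B * Bᵀ * K

/-- The closed-loop matrix `A(K) = A - BBᵀK`. -/
def closedLoop (A : Matrix n n ℝ) (B : Matrix n m ℝ) (K : Matrix n n ℝ) : Matrix n n ℝ :=
  A - B * Bᵀ * K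

/-- `Γ`: the symmetric solutions of the algebraic Riccati inequality `φ(K) ≥ 0`. -/
def ariSet (A : Matrix n n ℝ) (B : Matrix n m ℝ) (Q : Matrix n n ℝ) : Set (Matrix n n ℝ) :=
  {K | K.IsSymm ∧ (riccati A B Q K).PosSemidef}

/-- `∂Γ`: the symmetric solutions of the algebraic Riccati equation `φ(K) = 0`. -/
def areSet (A : Matrix n n ℝ) (B : Matrix n m ℝ) (Q : Matrix n n ℝ) : Set (Matrix n n ℝ) :=
  {K | K.IsSymm ∧ riccati A B Q K = 0}

/-- `Γ₋`: the negative semidefinite elements of `Γ`. -/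
def ariNegSet (A : Matrix n n ℝ) (B : Matrix n m ℝ) (Q : Matrix n n ℝ) : Set (Matrix n n ℝ) :=
  {K | K ∈ ariSet A B Q ∧ (-K).PosSemidef}

/-- `M` is the minimal (that is, least) element of `S` in the semidefinite order. -/
def IsMinimalElement (S : Set (Matrix n n ℝ)) (M : Matrix n n ℝ) : Prop :=
  M ∈ S ∧ ∀ N ∈ S, (N - M).PosSemidef

/-- `M` is the maximal (that is, greatest) element of `S` in the semidefinite order. -/
def IsMaximalElement (S : Set (Matrix n n ℝ)) (M : Matrix n n ℝ) : Prop :=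
  M ∈ S ∧ ∀ N ∈ S, (M - N).PosSemidef

/-- `(A, B)` is stabilizable: some state feedback `F` places `σ(A + BF)` in `Re z < 0`. -/
def Stabilizable (A : Matrix n n ℝ) (B : Matrix n m ℝ) : Prop :=
  ∃ F : Matrix m n ℝ, ∀ z ∈ spectrum ℂ ((A + B * F).map (algebraMap ℝ ℂ)), z.re < 0

/-- The controllable subspace `⟨A | Im B⟩ = Im B + A Im B + ⋯ + Aⁿ⁻¹ Im B`. -/
def controllableSubspace (A : Matrix n n ℝ) (B : Matrix n m ℝ) : Submodule ℝ (n → ℝ) :=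
  ⨆ i : Fin (Fintype.card n), (LinearMap.range B.mulVecLin).map (A ^ (i : ℕ)).mulVecLin

/-- `⟨V | A⟩ = {x | x, Ax, …, Aⁿ⁻¹x ∈ V}`; for `V = Ker W` this is
`Ker W ∩ Ker (WA) ∩ ⋯ ∩ Ker (WAⁿ⁻¹)`. -/
def unobservableSubspace (V : Submodule ℝ (n → ℝ)) (A : Matrix n n ℝ) : Submodule ℝ (n → ℝ) :=
  ⨅ i : Fin (Fintype.card n), V.comap (A ^ (i : ℕ)).mulVecLin

open Classical in
/-- The monic factor of the characteristic polynomial of `A` that collects, with multiplicity, the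
real irreducible factors all of whose complex roots have real part in `S`. (The roots of one real
irreducible polynomial are a real number or a conjugate pair, so they share their real part.) For
`S` the negative reals, `{0}` and the positive reals these are `p₋`, `p₀` and `p₊`. -/
noncomputable def spectralFactor (S : Set ℝ) (A : Matrix n n ℝ) : ℝ[X] :=
  ((UniqueFactorizationMonoid.normalizedFactors A.charpoly).filter
    (fun f => ∀ z : ℂ, aeval z f = 0 → z.re ∈ S)).prod

/-- `X⁻(A) = Ker p₋(A)`. -/
noncomputable def specNeg (A : Matrix n n ℝ) : Submodule ℝ (n → ℝ) :=
  LinearMap.ker (aeval A (spectralFactor (Set.Iio 0) A)).mulVecLin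

/-- `X⁰(A) = Ker p₀(A)`. -/
noncomputable def specZero (A : Matrix n n ℝ) : Submodule ℝ (n → ℝ) :=
  LinearMap.ker (aeval A (spectralFactor {0} A)).mulVecLin

/-- `X⁺(A) = Ker p₊(A)`. -/
noncomputable def specPos (A : Matrix n n ℝ) : Submodule ℝ (n → ℝ) :=
  LinearMap.ker (aeval A (spectralFactor (Set.Ioi 0) A)).mulVecLin

/-- The orthogonal complement for the standard inner product of `ℝⁿ`. -/
def orthComplement (V : Submodule ℝ (n → ℝ)) : Submodule ℝ (n → ℝ) where
  carrier := {y | ∀ v ∈ V, v ⬝ᵥ y = 0}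
  zero_mem' := fun v _ => dotProduct_zero v
  add_mem' := fun ha hb v hv => by rw [dotProduct_add, ha v hv, hb v hv, add_zero]
  smul_mem' := fun c y hy v hv => by rw [dotProduct_smul, hy v hv, smul_zero]

/-- `P` is the matrix of the projection onto `V` along `W`, where `ℝⁿ = V ⊕ W`. -/
def IsProjectionAlong (V W : Submodule ℝ (n → ℝ)) (P : Matrix n n ℝ) : Prop :=
  IsCompl V W ∧ (∀ x ∈ V, P *ᵥ x = x) ∧ ∀ x ∈ W, P *ᵥ x = 0

/-- `N(L) = ⟨L ∩ Ker K⁻ | A(K⁻)⟩ ∩ X⁺(A(K⁻))`, for `Km = K⁻`. -/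
noncomputable def subspaceN (A : Matrix n n ℝ) (B : Matrix n m ℝ) (Km : Matrix n n ℝ)
    (L : Submodule ℝ (n → ℝ)) : Submodule ℝ (n → ℝ) :=
  unobservableSubspace (L ⊓ LinearMap.ker Km.mulVecLin) (closedLoop A B Km) ⊓
    specPos (closedLoop A B Km)

/-- `Δ⁻¹(V^⊥) = {x | Δx ∈ V^⊥}`. -/
def gapPreimage (D : Matrix n n ℝ) (V : Submodule ℝ (n → ℝ)) : Submodule ℝ (n → ℝ) :=
  (orthComplement V).comap D.mulVecLin

/-- The span of the standard basis vectors with index in `J`. -/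
def coordSubspace (J : Set n) : Submodule ℝ (n → ℝ) :=
  Submodule.span ℝ ((fun j => Pi.single j (1 : ℝ)) '' J)

/-- The coordinates of `ℝⁿ`, split in three groups, are adapted to the decomposition
`ℝⁿ = X⁺(M) ⊕ X⁰(M) ⊕ X⁻(M)`. -/
def SpectrallyAdapted {n₁ n₂ n₃ : Type*} [Fintype n₁] [Fintype n₂] [Fintype n₃]
    [DecidableEq n₁] [DecidableEq n₂] [DecidableEq n₃]
    (M : Matrix (n₁ ⊕ (n₂ ⊕ n₃)) (n₁ ⊕ (n₂ ⊕ n₃)) ℝ) : Prop :=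
  specPos M = coordSubspace (Set.range Sum.inl) ∧
  specZero M = coordSubspace (Set.range (Sum.inr ∘ Sum.inl)) ∧
  specNeg M = coordSubspace (Set.range (Sum.inr ∘ Sum.inr))

end LQ

open LQ Matrix

namespace LQ

set_option linter.unusedSectionVars false

open Matrix Polynomial

/-! Restriction to the controllable subspace turns `K` in `Γ₋` into a solution `K₁` of the Riccati
inequality of a controllable pair. For such a pair the extremal solutions of the equation also bound
every solution of the inequality, so `K₁⁻ ≤ K₁ ≤ K₁⁺`. The block form is squeezed out of this
sandwich.

On the coordinates of `X⁺(A₁(K̄₁))`, which lies in `N₁` and hence in `ker K₁⁻`, the diagonal entries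
of `K` are at least those of `K₁⁻`, namely 0, and at most 0 because `K ≤ 0`. A zero diagonal entry
of a semidefinite matrix kills its whole row and column, including the part outside the controllable
subspace. On `X⁰(A₁(K̄₁))` the gap `Δ₁ = K₁⁺ - K₁⁻` vanishes, so the sandwich forces the columns of
`K₁` to be those of `K₁⁻`.

The maximal solution is the limit of Newton's iteration (`exists_maximal_solution`); the
construction also puts the spectrum of `A₁(K₁⁺)` in the closed left half plane. Hence `Δ₁` is
definite on `N₁`, which yields the direct sum (`isCompl_gapPreimage`). Its summands are invariant
under `A₁(K̄₁)`, which acts there as `A₁(K₁⁻)` and `A₁(K₁⁺)`; this locates the two spectral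
subspaces (`spec_supported`). That `Δ₁` kills the imaginary-axis part of `A₁(K₁⁺)` rests on
controllability (`gap_mulVec_eq_zero_of_eigen`). -/

section RiccatiTheory

variable {n m : Type*} [Fintype n] [DecidableEq n] [Fintype m]

/-! ### Complex eigenvalues of real matrices in terms of real vectors -/

/-- `a + ib` satisfies the eigenvector equation of `M` for the complex number `α + iβ`. -/
def EigPair (M : Matrix n n ℝ) (α β : ℝ) (a b : n → ℝ) : Prop :=
  M *ᵥ a = α • a - β • b ∧ M *ᵥ b = β • a + α • b

/-- All complex eigenvalues of the real matrix `M` have real part in `S`. -/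
def EigReIn (S : Set ℝ) (M : Matrix n n ℝ) : Prop :=
  ∀ α β a b, EigPair M α β a b → (a ≠ 0 ∨ b ≠ 0) → α ∈ S

theorem mulVec_complex (M : Matrix n n ℝ) (v : n → ℂ) :
    M.map (algebraMap ℝ ℂ) *ᵥ v =
      fun i => ⟨(M *ᵥ fun j => (v j).re) i, (M *ᵥ fun j => (v j).im) i⟩ := by
  funext i
  apply Complex.ext <;> simp [mulVec, dotProduct]

theorem eigPair_iff_complex (M : Matrix n n ℝ) (z : ℂ) (v : n → ℂ) :
    M.map (algebraMap ℝ ℂ) *ᵥ v = z • v ↔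
      EigPair M z.re z.im (fun i => (v i).re) (fun i => (v i).im) := by
  rw [mulVec_complex, EigPair]
  constructor
  · intro h
    constructor
    · funext i
      have := congrArg Complex.re (congrFun h i)
      simpa using this
    · funext i
      have := congrArg Complex.im (congrFun h i)
      simp at this ⊢
      linarith
  · rintro ⟨h1, h2⟩
    funext i
    have h1 := congrFun h1 i
    have h2 := congrFun h2 i
    apply Complex.ext
    · simpa using h1
    · simp at h2 ⊢
      linarith

theorem aeval_charpoly_complex (M : Matrix n n ℝ) (z : ℂ) :
    aeval z M.charpoly = (scalar n z - M.map (algebraMap ℝ ℂ)).det := by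
  rw [← eval_charpoly, charpoly_map, eval_map, aeval_def]

theorem aeval_charpoly_eq_zero_iff (M : Matrix n n ℝ) (z : ℂ) :
    aeval z M.charpoly = 0 ↔ ∃ a b, EigPair M z.re z.im a b ∧ (a ≠ 0 ∨ b ≠ 0) := by
  rw [aeval_charpoly_complex, ← exists_mulVec_eq_zero_iff]
  have key : ∀ v : n → ℂ, (scalar n z - M.map (algebraMap ℝ ℂ)) *ᵥ v = 0 ↔
      M.map (algebraMap ℝ ℂ) *ᵥ v = z • v := by
    intro v
    rw [sub_mulVec, sub_eq_zero, eq_comm, scalar_apply, ← smul_one_eq_diagonal, smul_mulVec,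
      one_mulVec]
  constructor
  · rintro ⟨v, hv, h⟩
    refine ⟨_, _, (eigPair_iff_complex M z v).1 ((key v).1 h), ?_⟩
    by_contra! h0
    apply hv
    funext i
    exact Complex.ext (congrFun h0.1 i) (congrFun h0.2 i)
  · rintro ⟨a, b, h, h0⟩
    refine ⟨fun i => ⟨a i, b i⟩, ?_, (key _).2 ((eigPair_iff_complex M z _).2 h)⟩
    intro hv
    rcases h0 with h0 | h0
    · exact h0 (funext fun i => congrArg Complex.re (congrFun hv i))
    · exact h0 (funext fun i => congrArg Complex.im (congrFun hv i))

theorem eigReIn_iff_charpoly (S : Set ℝ) (M : Matrix n n ℝ) :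
    EigReIn S M ↔ ∀ z : ℂ, aeval z M.charpoly = 0 → z.re ∈ S := by
  constructor
  · intro h z hz
    obtain ⟨a, b, hab, h0⟩ := (aeval_charpoly_eq_zero_iff M z).1 hz
    exact h _ _ _ _ hab h0
  · intro h α β a b hab h0
    exact h ⟨α, β⟩ ((aeval_charpoly_eq_zero_iff M ⟨α, β⟩).2 ⟨a, b, hab, h0⟩)

theorem dotProduct_mulVec_comm {X : Matrix n n ℝ} (hX : X.IsSymm) (x y : n → ℝ) :
    x ⬝ᵥ X *ᵥ y = y ⬝ᵥ X *ᵥ x := by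
  rw [dotProduct_mulVec, ← mulVec_transpose, hX.eq, dotProduct_comm]

theorem dotProduct_transpose_mulVec_left {k l : Type*} [Fintype k] [Fintype l]
    (M : Matrix k l ℝ) (x : l → ℝ) (y : k → ℝ) :
    x ⬝ᵥ Mᵀ *ᵥ y = (M *ᵥ x) ⬝ᵥ y := by
  rw [dotProduct_mulVec, vecMul_transpose]

theorem posSemidef_real_iff {X : Matrix n n ℝ} :
    X.PosSemidef ↔ X.IsSymm ∧ ∀ x : n → ℝ, 0 ≤ x ⬝ᵥ X *ᵥ x := by
  rw [posSemidef_iff_dotProduct_mulVec]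
  simp [IsHermitian, IsSymm, conjTranspose_eq_transpose_of_trivial]

theorem PosSemidef.mulVec_eq_zero {X : Matrix n n ℝ} (hX : X.PosSemidef) {x : n → ℝ}
    (h : x ⬝ᵥ X *ᵥ x = 0) : X *ᵥ x = 0 :=
  (hX.dotProduct_mulVec_zero_iff x).1 (by simpa using h)

/-- For `v = a + ib` and `λ = α + iβ` this is the identity `v*(MᵀX + XM)v = 2 Re λ · v*Xv`. It
converts definiteness of a Lyapunov expression into information on the real parts of eigenvalues. -/
theorem EigPair.lyapunov {M X : Matrix n n ℝ} (hX : X.IsSymm) {α β : ℝ} {a b : n → ℝ}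
    (h : EigPair M α β a b) :
    a ⬝ᵥ (Mᵀ * X + X * M) *ᵥ a + b ⬝ᵥ (Mᵀ * X + X * M) *ᵥ b =
      2 * α * (a ⬝ᵥ X *ᵥ a + b ⬝ᵥ X *ᵥ b) := by
  simp only [add_mulVec, dotProduct_add, dotProduct_transpose_mulVec_left, ← mulVec_mulVec, h.1, h.2,
    mulVec_add, mulVec_sub, mulVec_smul, add_dotProduct, sub_dotProduct, smul_dotProduct,
    dotProduct_sub, dotProduct_smul, smul_eq_mul, dotProduct_mulVec_comm hX b a]
  ring

/-! ### Stability and the Lyapunov equation -/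

section
attribute [local instance] Matrix.linftyOpNormedRing Matrix.linftyOpNormedAlgebra

/-- Powers of a complex matrix with spectral radius less than one tend to zero. -/
theorem tendsto_pow_zero_of_norm_lt_one (C : Matrix n n ℂ) (hC : ∀ z ∈ spectrum ℂ C, ‖z‖ < 1) :
    Filter.Tendsto (fun k : ℕ => C ^ k) Filter.atTop (nhds 0) := by
  have hc : CompleteSpace (Matrix n n ℂ) := FiniteDimensional.complete ℂ _
  rcases isEmpty_or_nonempty n with hn | hn
  · have : ∀ k, C ^ k = 0 := fun k => Subsingleton.elim _ _
    simp [this]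
  have hr : spectralRadius ℂ C < (1 : NNReal) :=
    spectrum.spectralRadius_lt_of_forall_lt C (fun z hz => hC z hz)
  obtain ⟨r, hr1, hr2⟩ := ENNReal.lt_iff_exists_nnreal_btwn.1 hr
  -- Gelfand's formula: `‖Cᵏ‖^(1/k)` tends to the spectral radius, so eventually `‖Cᵏ‖ ≤ rᵏ` with `r
  -- < 1`.
  have hlim := spectrum.pow_nnnorm_pow_one_div_tendsto_nhds_spectralRadius C
  have hev := hlim.eventually (gt_mem_nhds hr1)
  have hr2' : r < 1 := by exact_mod_cast hr2
  apply squeeze_zero_norm' (a := fun k : ℕ => (r : ℝ) ^ k)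
  · filter_upwards [hev, Filter.eventually_gt_atTop 0] with k hk hk0
    have h1 : (‖C ^ k‖₊ : ENNReal) ≤ (r : ENNReal) ^ (k : ℝ) := by
      rw [one_div] at hk
      exact ((ENNReal.rpow_inv_le_iff (by positivity)).1 hk.le)
    rw [ENNReal.rpow_natCast] at h1
    have h2 : ‖C ^ k‖₊ ≤ r ^ k := by exact_mod_cast h1
    exact_mod_cast h2
  · exact tendsto_pow_atTop_nhds_zero_of_lt_one r.2 (by exact_mod_cast hr2')

end

theorem tendsto_pow_zero_of_roots (C : Matrix n n ℝ)
    (hC : ∀ z : ℂ, aeval z C.charpoly = 0 → ‖z‖ < 1) :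
    Filter.Tendsto (fun k : ℕ => C ^ k) Filter.atTop (nhds 0) := by
  have h := tendsto_pow_zero_of_norm_lt_one (C.map (algebraMap ℝ ℂ)) (by
    intro z hz
    rw [mem_spectrum_iff_isRoot_charpoly, charpoly_map, IsRoot, eval_map, ← aeval_def] at hz
    exact hC z hz)
  refine tendsto_pi_nhds.2 fun i => tendsto_pi_nhds.2 fun j => ?_
  have h := (Complex.continuous_re.tendsto _).comp (tendsto_pi_nhds.1 (tendsto_pi_nhds.1 h i) j)
  refine h.congr fun k => ?_
  have : (C.map (algebraMap ℝ ℂ)) ^ k = (C ^ k).map (algebraMap ℝ ℂ) := by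
    simpa using (map_pow (RingHom.mapMatrix (algebraMap ℝ ℂ)) C k).symm
  simp only [Function.comp, this]
  simp

theorem EigReIn.sub_smul {S : Set ℝ} {M : Matrix n n ℝ} (h : EigReIn S M) (c : ℝ) :
    EigReIn {x | x + c ∈ S} (M - c • 1) := by
  intro α β a b hab h0
  refine h (α + c) β a b ⟨?_, ?_⟩ h0
  · have := hab.1
    rw [sub_mulVec, smul_mulVec, one_mulVec, sub_eq_iff_eq_add] at this
    rw [this]; module
  · have := hab.2
    rw [sub_mulVec, smul_mulVec, one_mulVec, sub_eq_iff_eq_add] at this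
    rw [this]; module

theorem EigReIn.transpose {S : Set ℝ} {M : Matrix n n ℝ} (h : EigReIn S M) : EigReIn S Mᵀ := by
  rw [eigReIn_iff_charpoly] at h ⊢
  rwa [charpoly_transpose]

theorem exists_eigReIn_Iio (M : Matrix n n ℝ) : ∃ c, 0 < c ∧ EigReIn (Set.Iio c) M := by
  have hfin : ((fun z : ℂ => z.re) '' (M.charpoly.rootSet ℂ)).Finite :=
    (rootSet_finite M.charpoly ℂ).image _
  obtain ⟨c, hc⟩ := hfin.bddAbove
  refine ⟨max c 0 + 1, by positivity, (eigReIn_iff_charpoly _ _).2 fun z hz => ?_⟩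
  have : z.re ≤ c := hc ⟨z, (mem_rootSet).2 ⟨(charpoly_monic M).ne_zero, hz⟩, rfl⟩
  have := le_max_left c 0
  simp only [Set.mem_Iio]
  linarith

theorem EigReIn.det_ne_zero {M : Matrix n n ℝ} {S : Set ℝ} (h : EigReIn S M) {c : ℝ}
    (hc : c ∉ S) : (c • 1 - M).det ≠ 0 := by
  intro h0
  obtain ⟨v, hv, h1⟩ := exists_mulVec_eq_zero_iff.2 h0
  rw [sub_mulVec, smul_mulVec, one_mulVec, sub_eq_zero] at h1
  refine hc (h c 0 v 0 ⟨by simp [h1], by simp⟩ (Or.inl hv))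

/-- Lyapunov's theorem: for a stable `M`, a symmetric `X` with `MᵀX + XM ≤ 0` is nonnegative. -/
theorem lyapunov_posSemidef {M X : Matrix n n ℝ} (hM : EigReIn (Set.Iio 0) M) (hX : X.IsSymm)
    (h : (-(Mᵀ * X + X * M)).PosSemidef) : X.PosSemidef := by
  have hdet : IsUnit (1 - M).det := by
    have := hM.det_ne_zero (c := 1) (by simp)
    rw [one_smul] at this
    exact this.isUnit
  set N := 1 - M with hN
  -- The Cayley transform maps the open left half plane into the open unit disc. Powers of `C` thus
  -- replace the matrix exponential of `M`.
  set C := (1 + M) * N⁻¹ with hC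
  have hx : ∀ x : n → ℝ, N⁻¹ *ᵥ x - M *ᵥ (N⁻¹ *ᵥ x) = x := by
    intro x
    have : N *ᵥ (N⁻¹ *ᵥ x) = x := by rw [mulVec_mulVec, mul_nonsing_inv _ hdet, one_mulVec]
    rw [hN, sub_mulVec, one_mulVec] at this
    exact this
  have hCx : ∀ x : n → ℝ, C *ᵥ x = N⁻¹ *ᵥ x + M *ᵥ (N⁻¹ *ᵥ x) := by
    intro x
    rw [hC, ← mulVec_mulVec, add_mulVec, one_mulVec]
  have hroots : ∀ z : ℂ, aeval z C.charpoly = 0 → ‖z‖ < 1 := by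
    intro z hz
    obtain ⟨a, b, hab, h0⟩ := (aeval_charpoly_eq_zero_iff C z).1 hz
    obtain ⟨α, β⟩ := z
    simp only at hab
    have ha := hab.1
    have hb := hab.2
    rw [hCx] at ha hb
    have hxa := hx a
    have hxb := hx b
    set u := N⁻¹ *ᵥ a
    set v := N⁻¹ *ᵥ b
    have ha' : ∀ i, u i + (M *ᵥ u) i = α * (u i - (M *ᵥ u) i) - β * (v i - (M *ᵥ v) i) := by
      intro i
      have := congrFun ha i
      rw [← hxa, ← hxb] at this
      simpa using this
    have hb' : ∀ i, v i + (M *ᵥ v) i = β * (u i - (M *ᵥ u) i) + α * (v i - (M *ᵥ v) i) := by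
      intro i
      have := congrFun hb i
      rw [← hxa, ← hxb] at this
      simpa using this
    have huv : u ≠ 0 ∨ v ≠ 0 := by
      by_contra! h1
      rw [h1.1] at hxa
      rw [h1.2] at hxb
      simp at hxa hxb
      rcases h0 with h0 | h0
      · exact h0 hxa.symm
      · exact h0 hxb.symm
    have hD : 0 < (1 + α) ^ 2 + β ^ 2 := by
      by_contra! hle
      have hβ : β = 0 := by nlinarith [sq_nonneg (1 + α), sq_nonneg β]
      have hα : 1 + α = 0 := by nlinarith [sq_nonneg (1 + α), sq_nonneg β]
      have hα : α = -1 := by linarith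
      subst hβ hα
      rcases huv with h1 | h1
      · exact h1 (funext fun i => by have := ha' i; simp; linarith)
      · exact h1 (funext fun i => by have := hb' i; simp; linarith)
    -- An eigenvalue `λ` of `C` comes from the eigenvalue `(λ - 1)/(λ + 1)` of `M`, whose real part
    -- is `(|λ|² - 1)/|λ + 1|²`.
    have hpair : EigPair M ((α ^ 2 + β ^ 2 - 1) / ((1 + α) ^ 2 + β ^ 2))
        (2 * β / ((1 + α) ^ 2 + β ^ 2)) u v := by
      constructor
      · funext i
        have h1 := ha' i
        have h2 := hb' i
        simp only [Pi.sub_apply, Pi.smul_apply, smul_eq_mul]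
        field_simp
        linear_combination (1 + α) * h1 + β * h2
      · funext i
        have h1 := ha' i
        have h2 := hb' i
        simp only [Pi.add_apply, Pi.smul_apply, smul_eq_mul]
        field_simp
        linear_combination (1 + α) * h2 - β * h1
    have hneg := hM _ _ _ _ hpair huv
    rw [Set.mem_Iio, div_neg_iff] at hneg
    have : α ^ 2 + β ^ 2 < 1 := by
      rcases hneg with h2 | h2 <;> linarith [h2.1, h2.2]
    rw [← sq_lt_one_iff₀ (norm_nonneg _), Complex.sq_norm, Complex.normSq_mk]
    linarith
  -- With `w = N⁻¹x` one has `x = w - Mw` and `Cx = w + Mw`, so the two forms differ by `2 wᵀ(MᵀX +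
  -- XM)w ≤ 0`. Iterating and letting `Cᵏ` tend to 0 gives `0 ≤ xᵀXx`.
  have hdec : ∀ x : n → ℝ, (C *ᵥ x) ⬝ᵥ X *ᵥ (C *ᵥ x) ≤ x ⬝ᵥ X *ᵥ x := by
    intro x
    have h1 := (posSemidef_real_iff.1 h).2 (N⁻¹ *ᵥ x)
    rw [hCx]
    conv_rhs => rw [← hx x]
    set w := N⁻¹ *ᵥ x
    simp only [neg_mulVec, add_mulVec, dotProduct_neg, dotProduct_add, ← mulVec_mulVec,
      dotProduct_transpose_mulVec_left, mulVec_add, mulVec_sub, add_dotProduct, sub_dotProduct,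
      dotProduct_sub] at h1 ⊢
    linarith
  have hdeck : ∀ (k : ℕ) (x : n → ℝ), (C ^ k *ᵥ x) ⬝ᵥ X *ᵥ (C ^ k *ᵥ x) ≤ x ⬝ᵥ X *ᵥ x := by
    intro k
    induction k with
    | zero => intro x; simp
    | succ k ih =>
      intro x
      rw [pow_succ, ← mulVec_mulVec]
      exact (ih _).trans (hdec x)
  refine posSemidef_real_iff.2 ⟨hX, fun x => ?_⟩
  have hlim := tendsto_pow_zero_of_roots C hroots
  have hcont : Continuous fun Y : Matrix n n ℝ => (Y *ᵥ x) ⬝ᵥ X *ᵥ (Y *ᵥ x) := by fun_prop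
  have := (hcont.tendsto 0).comp hlim
  simp only [zero_mulVec, zero_dotProduct] at this
  exact le_of_tendsto' this fun k => hdeck k x

/-- The symmetric matrices. -/
def symmSubmodule (n : Type*) : Submodule ℝ (Matrix n n ℝ) where
  carrier := {X | X.IsSymm}
  zero_mem' := isSymm_zero
  add_mem' := fun ha hb => IsSymm.add ha hb
  smul_mem' := fun c _ hx => IsSymm.smul hx c

/-- The Lyapunov operator maps the finite-dimensional space of symmetric matrices to itself, so
injectivity suffices. If it kills `X`, Lyapunov's theorem applies to both `X` and `-X`, whence `X =
0`. -/
theorem exists_lyapunov_solution {M R : Matrix n n ℝ} (hM : EigReIn (Set.Iio 0) M)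
    (hR : R.IsSymm) : ∃ X : Matrix n n ℝ, X.IsSymm ∧ Mᵀ * X + X * M = R := by
  let f : Matrix n n ℝ →ₗ[ℝ] Matrix n n ℝ :=
    LinearMap.mulLeft ℝ Mᵀ + LinearMap.mulRight ℝ M
  have hf : ∀ X, f X = Mᵀ * X + X * M := fun X => rfl
  have hmaps : ∀ X ∈ symmSubmodule n, f X ∈ symmSubmodule n := by
    intro X hX
    have hX : Xᵀ = X := hX
    change (f X)ᵀ = f X
    rw [hf, transpose_add, transpose_mul, transpose_mul, hX, transpose_transpose, add_comm]
  have hinj : Function.Injective (f.restrict hmaps) := by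
    rw [← LinearMap.ker_eq_bot, LinearMap.ker_eq_bot']
    rintro ⟨X, hX⟩ h
    have hX : X.IsSymm := hX
    have h : Mᵀ * X + X * M = 0 := congrArg Subtype.val h
    have h1 : X.PosSemidef := lyapunov_posSemidef hM hX (by rw [h, neg_zero]; exact .zero)
    have h2 : (-X).PosSemidef := lyapunov_posSemidef hM hX.neg (by
      rw [Matrix.mul_neg, Matrix.neg_mul, ← neg_add, h, neg_zero, neg_zero]; exact .zero)
    apply Subtype.ext
    change X = 0
    have : ∀ x, X *ᵥ x = 0 := by
      intro x
      apply PosSemidef.mulVec_eq_zero h1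
      have h3 := (posSemidef_real_iff.1 h1).2 x
      have h4 := (posSemidef_real_iff.1 h2).2 x
      rw [neg_mulVec, dotProduct_neg] at h4
      linarith
    ext i j
    simpa using congrFun (this (Pi.single j 1)) i
  obtain ⟨⟨X, hX⟩, h⟩ := LinearMap.injective_iff_surjective.1 hinj ⟨R, hR⟩
  exact ⟨X, hX, congrArg Subtype.val h⟩

/-! ### Stabilization of a controllable pair -/

/-- Controllability, dually: no nonzero vector annihilates all `AᵏB`. -/
def Controllable (A : Matrix n n ℝ) (B : Matrix n m ℝ) : Prop :=
  ∀ x : n → ℝ, (∀ k : ℕ, Bᵀ *ᵥ (Aᵀ ^ k *ᵥ x) = 0) → x = 0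

/-- A controllable pair is stabilized by some feedback (Bass). -/
theorem Controllable.exists_stable {A : Matrix n n ℝ} {B : Matrix n m ℝ} (h : Controllable A B) :
    ∃ F : Matrix m n ℝ, EigReIn (Set.Iio 0) (A + B * F) := by
  obtain ⟨c, hc, hcA⟩ := exists_eigReIn_Iio (-Aᵀ)
  have hst : EigReIn (Set.Iio 0) (-Aᵀ - c • 1) := by
    intro α β a b hab h0
    have := hcA.sub_smul c α β a b hab h0
    simpa using this
  -- `W` solves `(A + c)W + W(A + c)ᵀ = 2BBᵀ`; the shift `c` is large enough to make `-(A + c)ᵀ`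
  -- stable.
  obtain ⟨W, hW, hWeq⟩ := exists_lyapunov_solution (R := -(2 : ℝ) • (B * Bᵀ)) hst (by
    rw [IsSymm, transpose_smul, transpose_mul, transpose_transpose])
  have hWpsd : W.PosSemidef := by
    refine lyapunov_posSemidef hst hW ?_
    rw [hWeq, posSemidef_real_iff]
    constructor
    · rw [IsSymm, transpose_neg, transpose_smul, transpose_mul, transpose_transpose]
    · intro x
      have h1 := dotProduct_transpose_mulVec_left Bᵀ x (Bᵀ *ᵥ x)
      rw [transpose_transpose] at h1
      rw [neg_mulVec, smul_mulVec, ← mulVec_mulVec, dotProduct_neg, dotProduct_smul, h1,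
        smul_eq_mul]
      have := Finset.sum_nonneg fun i (_ : i ∈ Finset.univ) => mul_self_nonneg ((Bᵀ *ᵥ x) i)
      rw [← dotProduct] at this
      linarith
  have hWeq' : A * W + W * Aᵀ = (2 : ℝ) • (B * Bᵀ) - (2 * c) • W := by
    rw [transpose_sub, transpose_neg, transpose_transpose, transpose_smul, transpose_one,
      Matrix.sub_mul, Matrix.mul_sub, Matrix.neg_mul, Matrix.mul_neg, Matrix.smul_mul, Matrix.mul_smul,
      Matrix.one_mul, Matrix.mul_one] at hWeq
    have h1 : A * W + W * Aᵀ = -(-(A * W) - c • W + (-(W * Aᵀ) - c • W)) - (2 * c) • W := by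
      module
    rw [h1, hWeq]
    module
  -- The kernel of `W` is `Aᵀ`-invariant and lies in `ker Bᵀ`, so controllability makes `W`
  -- invertible.
  have hker : ∀ x, W *ᵥ x = 0 → Bᵀ *ᵥ x = 0 ∧ W *ᵥ (Aᵀ *ᵥ x) = 0 := by
    intro x hx
    have h1 : (A * W + W * Aᵀ) *ᵥ x = ((2 : ℝ) • (B * Bᵀ) - (2 * c) • W) *ᵥ x := by rw [hWeq']
    simp only [add_mulVec, sub_mulVec, smul_mulVec, ← mulVec_mulVec, hx, mulVec_zero, zero_add,
      smul_zero, sub_zero] at h1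
    have h2 : x ⬝ᵥ W *ᵥ (Aᵀ *ᵥ x) = 0 := by
      rw [dotProduct_mulVec_comm hW, hx, dotProduct_zero]
    have h3 := dotProduct_transpose_mulVec_left Bᵀ x (Bᵀ *ᵥ x)
    rw [transpose_transpose] at h3
    rw [h1, dotProduct_smul, h3, smul_eq_mul] at h2
    have h4 : Bᵀ *ᵥ x = 0 := dotProduct_self_eq_zero.1 (by linarith)
    refine ⟨h4, ?_⟩
    rw [h1, h4, mulVec_zero, smul_zero]
  have hinj : ∀ x, W *ᵥ x = 0 → x = 0 := by
    intro x hx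
    have h1 : ∀ k : ℕ, W *ᵥ (Aᵀ ^ k *ᵥ x) = 0 := by
      intro k
      induction k with
      | zero => simpa using hx
      | succ k ih => rw [pow_succ', ← mulVec_mulVec]; exact (hker _ ih).2
    exact h x fun k => (hker _ (h1 k)).1
  have hdet : IsUnit W.det := by
    rw [isUnit_iff_ne_zero]
    intro h0
    obtain ⟨v, hv, h1⟩ := exists_mulVec_eq_zero_iff.2 h0
    exact hv (hinj v h1)
  refine ⟨-(Bᵀ * W⁻¹), ?_⟩
  rw [← transpose_transpose (A + B * -(Bᵀ * W⁻¹))]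
  apply EigReIn.transpose
  set G := A + B * -(Bᵀ * W⁻¹) with hG
  -- Since `W` is positive definite, this identity puts every eigenvalue of `Gᵀ` on the line `Re z =
  -- -c`.
  have hGW : G * W + W * Gᵀ = -(2 * c) • W := by
    have h1 : G * W = A * W - B * Bᵀ := by
      rw [hG, Matrix.add_mul, Matrix.mul_neg, Matrix.neg_mul, Matrix.mul_assoc, Matrix.mul_assoc,
        nonsing_inv_mul _ hdet, Matrix.mul_one, sub_eq_add_neg]
    have h2 : W * Gᵀ = W * Aᵀ - B * Bᵀ := by
      have := congrArg transpose h1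
      rwa [transpose_mul, hW.eq, transpose_sub, transpose_mul, transpose_mul, hW.eq,
        transpose_transpose] at this
    have h3 : G * W + W * Gᵀ = (A * W + W * Aᵀ) - (2 : ℝ) • (B * Bᵀ) := by
      rw [h1, h2]; module
    rw [h3, hWeq']
    module
  intro α β a b hab h0
  have h1 := hab.lyapunov hW
  rw [transpose_transpose, hGW] at h1
  simp only [smul_mulVec, dotProduct_smul, smul_eq_mul] at h1
  have ha := (posSemidef_real_iff.1 hWpsd).2 a
  have hb := (posSemidef_real_iff.1 hWpsd).2 b
  have hpos : 0 < a ⬝ᵥ W *ᵥ a + b ⬝ᵥ W *ᵥ b := by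
    rcases (add_nonneg ha hb).lt_or_eq with h2 | h2
    · exact h2
    · exfalso
      rcases h0 with h0 | h0
      · exact h0 (hinj a (PosSemidef.mulVec_eq_zero hWpsd (by linarith)))
      · exact h0 (hinj b (PosSemidef.mulVec_eq_zero hWpsd (by linarith)))
  have : α = -c := by
    have : (α + c) * (a ⬝ᵥ W *ᵥ a + b ⬝ᵥ W *ᵥ b) = 0 := by linarith
    rcases mul_eq_zero.1 this with h2 | h2 <;> linarith
  simp [this, hc]

theorem posSemidef_transpose_mul_self (G : Matrix m n ℝ) : (Gᵀ * G).PosSemidef := by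
  have := posSemidef_conjTranspose_mul_self G
  rwa [conjTranspose_eq_transpose_of_trivial] at this

theorem dotProduct_transpose_mul_self_mulVec (G : Matrix m n ℝ) (x : n → ℝ) :
    x ⬝ᵥ (Gᵀ * G) *ᵥ x = (G *ᵥ x) ⬝ᵥ (G *ᵥ x) := by
  rw [← mulVec_mulVec, dotProduct_transpose_mulVec_left]

theorem real_dotProduct_self_nonneg (x : m → ℝ) : 0 ≤ x ⬝ᵥ x :=
  Finset.sum_nonneg fun i _ => mul_self_nonneg (x i)

/-! ### Newton's iteration for the Riccati equation -/

section Newton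

variable {A : Matrix n n ℝ} {B : Matrix n m ℝ} {Q K X : Matrix n n ℝ} {F : Matrix m n ℝ}

/-- Completing the square: the Lyapunov expression of `K - X` under `A + BF` is minus `φ(X) + (F +
BᵀX)ᵀ(F + BᵀX)`. Here `K` is the cost matrix of the stable feedback `F`. -/
theorem newton_sub_posSemidef (hF : EigReIn (Set.Iio 0) (A + B * F)) (hK : K.IsSymm)
    (hKeq : (A + B * F)ᵀ * K + K * (A + B * F) = -(Q + Fᵀ * F)) (hX : X ∈ ariSet A B Q) :
    (K - X).PosSemidef := by
  refine lyapunov_posSemidef hF (hK.sub hX.1) ?_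
  have hXs : Xᵀ = X := hX.1
  have : -((A + B * F)ᵀ * (K - X) + (K - X) * (A + B * F)) =
      riccati A B Q X + (F + Bᵀ * X)ᵀ * (F + Bᵀ * X) := by
    refine (sub_eq_zero.1 (Eq.trans ?_ (sub_eq_zero.2 hKeq.symm)))
    simp only [riccati, transpose_add, transpose_mul, transpose_transpose, hXs, Matrix.mul_add,
      Matrix.add_mul, Matrix.mul_sub, Matrix.sub_mul, Matrix.mul_assoc]
    abel
  rw [this]
  exact hX.2.add (posSemidef_transpose_mul_self _)

/-- The next feedback is `F' = -BᵀK`. The Lyapunov expression of `K - X ≥ 0` under `A + BF'` is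
minus a sum of nonnegative terms, one of them `(F' - F)ᵀ(F' - F)`. An eigenvector with `Re λ ≥ 0`
must make every term vanish, so `F` and `F'` agree on it and it is an eigenvector of the stable `A +
BF`, which is impossible. -/
theorem newton_stable (hF : EigReIn (Set.Iio 0) (A + B * F)) (hK : K.IsSymm)
    (hKeq : (A + B * F)ᵀ * K + K * (A + B * F) = -(Q + Fᵀ * F)) (hX : X ∈ ariSet A B Q) :
    EigReIn (Set.Iio 0) (A + B * -(Bᵀ * K)) := by
  have hD := newton_sub_posSemidef hF hK hKeq hX
  have hXs : Xᵀ = X := hX.1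
  have hKs : Kᵀ = K := hK
  have key : (A + B * -(Bᵀ * K))ᵀ * (K - X) + (K - X) * (A + B * -(Bᵀ * K)) =
      -(riccati A B Q X + (-(Bᵀ * K) + Bᵀ * X)ᵀ * (-(Bᵀ * K) + Bᵀ * X) +
        (-(Bᵀ * K) - F)ᵀ * (-(Bᵀ * K) - F)) := by
    refine (sub_eq_zero.1 (Eq.trans ?_ (sub_eq_zero.2 hKeq)))
    simp only [riccati, transpose_add, transpose_sub, transpose_neg, transpose_mul,
      transpose_transpose, hXs, hKs, Matrix.mul_add, Matrix.add_mul, Matrix.mul_sub, Matrix.sub_mul,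
      Matrix.mul_neg, Matrix.neg_mul, Matrix.mul_assoc]
    abel
  generalize -(Bᵀ * K) + Bᵀ * X = G at key
  intro α β a b hab h0
  by_contra hα
  simp only [Set.mem_Iio, not_lt] at hα
  have h1 := hab.lyapunov (hK.sub hX.1)
  rw [key] at h1
  simp only [neg_mulVec, add_mulVec, dotProduct_neg, dotProduct_add,
    dotProduct_transpose_mul_self_mulVec] at h1
  have h2 := (posSemidef_real_iff.1 hX.2).2 a
  have h3 := (posSemidef_real_iff.1 hX.2).2 b
  have h4 := real_dotProduct_self_nonneg (G *ᵥ a)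
  have h5 := real_dotProduct_self_nonneg (G *ᵥ b)
  have h6 := real_dotProduct_self_nonneg ((-(Bᵀ * K) - F) *ᵥ a)
  have h7 := real_dotProduct_self_nonneg ((-(Bᵀ * K) - F) *ᵥ b)
  have h8 := (posSemidef_real_iff.1 hD).2 a
  have h9 := (posSemidef_real_iff.1 hD).2 b
  have h10 : 0 ≤ 2 * α * (a ⬝ᵥ (K - X) *ᵥ a + b ⬝ᵥ (K - X) *ᵥ b) := by positivity
  have ha : (-(Bᵀ * K) - F) *ᵥ a = 0 := dotProduct_self_eq_zero.1 (by linarith)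
  have hb : (-(Bᵀ * K) - F) *ᵥ b = 0 := dotProduct_self_eq_zero.1 (by linarith)
  have hsame : ∀ x, (-(Bᵀ * K) - F) *ᵥ x = 0 →
      (A + B * F) *ᵥ x = (A + B * -(Bᵀ * K)) *ᵥ x := by
    intro x hx
    rw [sub_mulVec, sub_eq_zero] at hx
    rw [add_mulVec, add_mulVec, ← mulVec_mulVec, ← mulVec_mulVec, hx]
  have := hF α β a b ⟨(hsame a ha).trans hab.1, (hsame b hb).trans hab.2⟩ h0
  exact absurd this (by simpa using hα)

/-- Subtracting the two Lyapunov equations leaves the single square `(F' - F)ᵀ(F' - F)`, with `F' =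
-BᵀK`. The bound `X` serves only to make `A + BF'` stable. -/
theorem newton_antitone (hF : EigReIn (Set.Iio 0) (A + B * F)) (hK : K.IsSymm)
    (hKeq : (A + B * F)ᵀ * K + K * (A + B * F) = -(Q + Fᵀ * F)) (hX : X ∈ ariSet A B Q)
    {K' : Matrix n n ℝ} (hK' : K'.IsSymm)
    (hKeq' : (A + B * -(Bᵀ * K))ᵀ * K' + K' * (A + B * -(Bᵀ * K)) =
      -(Q + (-(Bᵀ * K))ᵀ * (-(Bᵀ * K)))) :
    (K - K').PosSemidef := by
  refine lyapunov_posSemidef (newton_stable hF hK hKeq hX) (hK.sub hK') ?_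
  have hKs : Kᵀ = K := hK
  have : -((A + B * -(Bᵀ * K))ᵀ * (K - K') + (K - K') * (A + B * -(Bᵀ * K))) =
      (-(Bᵀ * K) - F)ᵀ * (-(Bᵀ * K) - F) := by
    have h : -((A + B * -(Bᵀ * K))ᵀ * (K - K') + (K - K') * (A + B * -(Bᵀ * K))) =
      ((A + B * -(Bᵀ * K))ᵀ * K' + K' * (A + B * -(Bᵀ * K))) -
      ((A + B * -(Bᵀ * K))ᵀ * K + K * (A + B * -(Bᵀ * K))) := by
      rw [Matrix.mul_sub, Matrix.sub_mul]; abel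
    rw [h, hKeq']
    refine (sub_eq_zero.1 (Eq.trans ?_ (sub_eq_zero.2 hKeq.symm)))
    simp only [transpose_add, transpose_sub, transpose_neg, transpose_mul,
      transpose_transpose, hKs, Matrix.mul_add, Matrix.add_mul, Matrix.mul_sub, Matrix.sub_mul,
      Matrix.mul_neg, Matrix.neg_mul, Matrix.mul_assoc]
    abel
  rw [this]
  exact posSemidef_transpose_mul_self _

end Newton

/-! ### Monotone limits and extremal solutions -/

theorem apply_eq_dotProduct {X : Matrix n n ℝ} (hX : X.IsSymm) (i j : n) :
    X i j = ((Pi.single i 1 + Pi.single j 1 : n → ℝ) ⬝ᵥ X *ᵥ (Pi.single i 1 + Pi.single j 1) -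
      (Pi.single i 1 : n → ℝ) ⬝ᵥ X *ᵥ Pi.single i 1 -
      (Pi.single j 1 : n → ℝ) ⬝ᵥ X *ᵥ Pi.single j 1) / 2 := by
  have h : ∀ a b : n, (Pi.single a 1 : n → ℝ) ⬝ᵥ X *ᵥ Pi.single b 1 = X a b := by
    intro a b; simp
  simp only [mulVec_add, dotProduct_add, add_dotProduct, h]
  rw [hX.apply i j]
  ring

/-- A decreasing sequence of symmetric matrices that is bounded below converges. -/
theorem exists_tendsto_of_antitone {K : ℕ → Matrix n n ℝ} {X : Matrix n n ℝ}
    (hK : ∀ k, (K k).IsSymm) (hanti : ∀ k, (K k - K (k + 1)).PosSemidef)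
    (hbdd : ∀ k, (K k - X).PosSemidef) :
    ∃ Y : Matrix n n ℝ, Filter.Tendsto K Filter.atTop (nhds Y) := by
  have hq : ∀ x : n → ℝ, ∃ y, Filter.Tendsto (fun k => x ⬝ᵥ K k *ᵥ x) Filter.atTop (nhds y) := by
    intro x
    refine ⟨_, tendsto_atTop_ciInf (antitone_nat_of_succ_le fun k => ?_)
      ⟨x ⬝ᵥ X *ᵥ x, ?_⟩⟩
    · have := (posSemidef_real_iff.1 (hanti k)).2 x
      rw [sub_mulVec, dotProduct_sub] at this
      linarith
    · rintro _ ⟨k, rfl⟩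
      have := (posSemidef_real_iff.1 (hbdd k)).2 x
      rw [sub_mulVec, dotProduct_sub] at this
      simp only
      linarith
  choose y hy using hq
  refine ⟨fun i j => (y (Pi.single i 1 + Pi.single j 1) - y (Pi.single i 1) -
    y (Pi.single j 1)) / 2, tendsto_pi_nhds.2 fun i => tendsto_pi_nhds.2 fun j => ?_⟩
  -- By polarization, convergence of the quadratic forms gives convergence of every entry.
  refine Filter.Tendsto.congr (fun k => (apply_eq_dotProduct (hK k) i j).symm) ?_
  exact (((hy _).sub (hy _)).sub (hy _)).div_const 2

theorem posSemidef_of_tendsto {K : ℕ → Matrix n n ℝ} {Y : Matrix n n ℝ}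
    (h : Filter.Tendsto K Filter.atTop (nhds Y)) (hK : ∀ k, (K k).PosSemidef) : Y.PosSemidef := by
  refine posSemidef_real_iff.2 ⟨?_, fun x => ?_⟩
  · have h1 : Filter.Tendsto (fun k => (K k)ᵀ) Filter.atTop (nhds Yᵀ) :=
      (continuous_id.matrix_transpose.tendsto Y).comp h
    have h2 : ∀ k, (K k)ᵀ = K k := fun k => (posSemidef_real_iff.1 (hK k)).1
    simp only [h2] at h1
    exact tendsto_nhds_unique h1 h
  · have hcont : Continuous fun Z : Matrix n n ℝ => x ⬝ᵥ Z *ᵥ x := by fun_prop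
    exact ge_of_tendsto' ((hcont.tendsto Y).comp h) fun k => (posSemidef_real_iff.1 (hK k)).2 x

/-- A limit of stable matrices has its spectrum in the closed left half plane. -/
theorem eigReIn_Iic_of_tendsto {M : ℕ → Matrix n n ℝ} {Y : Matrix n n ℝ}
    (h : Filter.Tendsto M Filter.atTop (nhds Y)) (hM : ∀ k, EigReIn (Set.Iio 0) (M k)) :
    EigReIn (Set.Iic 0) Y := by
  rw [eigReIn_iff_charpoly]
  intro z hz
  by_contra hre
  simp only [Set.mem_Iic, not_le] at hre
  have hcont : Continuous fun Z : Matrix n n ℝ =>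
      ‖(scalar n z - Z.map (algebraMap ℝ ℂ)).det‖ := by
    have h1 : Continuous fun Z : Matrix n n ℝ => Z.map (algebraMap ℝ ℂ) :=
      continuous_id.matrix_map Complex.continuous_ofReal
    exact ((continuous_const.sub h1).matrix_det).norm
  have hlim := (hcont.tendsto Y).comp h
  rw [aeval_charpoly_complex] at hz
  simp only [hz, norm_zero] at hlim
  -- The modulus `|det(z - M k)|` is the product of the distances from `z` to the eigenvalues, each
  -- at least `Re z > 0`. The determinants therefore cannot tend to 0.
  have hlow : ∀ k, z.re ^ Fintype.card n ≤ ‖(scalar n z - (M k).map (algebraMap ℝ ℂ)).det‖ := by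
    intro k
    rw [← eval_charpoly]
    set p := ((M k).map (algebraMap ℝ ℂ)).charpoly with hp
    have hm : p.Monic := charpoly_monic _
    have hs : p.Splits := IsAlgClosed.splits p
    rw [hs.eval_eq_prod_roots_of_monic hm]
    have hcard : p.roots.card = Fintype.card n := by
      rw [← hs.natDegree_eq_card_roots, hp, charpoly_natDegree_eq_dim]
    have hroots : ∀ w ∈ p.roots, z.re ≤ ‖z - w‖ := by
      intro w hw
      have hw' : aeval w (M k).charpoly = 0 := by
        have := (mem_roots hm.ne_zero).1 hw
        rwa [hp, charpoly_map, IsRoot, eval_map, ← aeval_def] at this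
      have h1 : w.re < 0 := (eigReIn_iff_charpoly _ _).1 (hM k) w hw'
      have h2 := Complex.re_le_norm (z - w)
      rw [Complex.sub_re] at h2
      linarith
    rw [← hcard]
    generalize p.roots = s at hroots
    induction s using Multiset.induction_on with
    | empty => simp
    | cons w s ih =>
      rw [Multiset.card_cons, Multiset.map_cons, Multiset.prod_cons, norm_mul, pow_succ']
      exact mul_le_mul (hroots w (Multiset.mem_cons_self _ _))
        (ih fun v hv => hroots v (Multiset.mem_cons_of_mem hv)) (by positivity) (norm_nonneg _)
  have := ge_of_tendsto' hlim hlow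
  have : 0 < z.re ^ Fintype.card n := by positivity
  linarith

/-- A controllable pair with a solvable Riccati inequality has a solution of the Riccati equation
that dominates all solutions of the inequality, and its closed loop has no spectrum in the open
right half plane. -/
theorem exists_maximal_solution {A : Matrix n n ℝ} {B : Matrix n m ℝ} {Q : Matrix n n ℝ}
    (hQ : Q.IsSymm) (hAB : Controllable A B) (hne : (ariSet A B Q).Nonempty) :
    ∃ K ∈ areSet A B Q, (∀ X ∈ ariSet A B Q, (K - X).PosSemidef) ∧
      EigReIn (Set.Iic 0) (closedLoop A B K) := by
  obtain ⟨X₀, hX₀⟩ := hne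
  obtain ⟨F₀, hF₀⟩ := hAB.exists_stable
  have hex : ∀ F : {F : Matrix m n ℝ // EigReIn (Set.Iio 0) (A + B * F)}, ∃ K : Matrix n n ℝ,
      K.IsSymm ∧ (A + B * F.1)ᵀ * K + K * (A + B * F.1) = -(Q + F.1ᵀ * F.1) := by
    intro F
    refine exists_lyapunov_solution F.2 (IsSymm.neg (hQ.add ?_))
    rw [IsSymm, transpose_mul, transpose_transpose]
  choose S hS hSeq using hex
  let F : ℕ → {F : Matrix m n ℝ // EigReIn (Set.Iio 0) (A + B * F)} := fun k =>
    Nat.rec ⟨F₀, hF₀⟩ (fun _ F => ⟨-(Bᵀ * S F), newton_stable F.2 (hS F) (hSeq F) hX₀⟩) k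
  have hFs : ∀ k, (F (k + 1)).1 = -(Bᵀ * S (F k)) := fun k => rfl
  obtain ⟨Y, hY⟩ := exists_tendsto_of_antitone (K := fun k => S (F k)) (X := X₀)
    (fun k => hS _)
    (fun k => newton_antitone (F k).2 (hS _) (hSeq _) hX₀ (hS _) (hSeq (F (k + 1))))
    (fun k => newton_sub_posSemidef (F k).2 (hS _) (hSeq _) hX₀)
  have hmax : ∀ X ∈ ariSet A B Q, (Y - X).PosSemidef := fun X hX =>
    posSemidef_of_tendsto (hY.sub tendsto_const_nhds)
      fun k => newton_sub_posSemidef (F k).2 (hS _) (hSeq _) hX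
  have hYs : Y.IsSymm := by
    have := (posSemidef_real_iff.1 (hmax X₀ hX₀)).1.add hX₀.1
    rwa [sub_add_cancel] at this
  have hY1 := (Filter.tendsto_add_atTop_iff_nat 1).2 hY
  refine ⟨Y, ⟨hYs, ?_⟩, hmax, ?_⟩
  -- Each Lyapunov equation couples two consecutive iterates. Both tend to `Y`, and with the two
  -- equal the equation becomes `φ(Y) = 0`.
  · have hcont : Continuous fun Z : Matrix n n ℝ × Matrix n n ℝ =>
        (A + B * -(Bᵀ * Z.1))ᵀ * Z.2 + Z.2 * (A + B * -(Bᵀ * Z.1)) +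
          (Q + (-(Bᵀ * Z.1))ᵀ * (-(Bᵀ * Z.1))) := by fun_prop
    have h1 := (hcont.tendsto (Y, Y)).comp (hY.prodMk_nhds hY1)
    have h2 : ∀ k, (A + B * -(Bᵀ * S (F k)))ᵀ * S (F (k + 1)) +
        S (F (k + 1)) * (A + B * -(Bᵀ * S (F k))) +
          (Q + (-(Bᵀ * S (F k)))ᵀ * (-(Bᵀ * S (F k)))) = 0 := fun k => by
      have := hSeq (F (k + 1))
      rw [hFs] at this
      rw [this, neg_add_cancel]
    have h3 := tendsto_nhds_unique (h1.congr h2) tendsto_const_nhds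
    have hYs' : Yᵀ = Y := hYs
    rw [← h3]
    simp only [riccati, transpose_add, transpose_neg, transpose_mul,
      transpose_transpose, hYs', Matrix.mul_add, Matrix.add_mul,
      Matrix.mul_neg, Matrix.neg_mul, Matrix.mul_assoc]
    abel
  · have hcont : Continuous fun Z : Matrix n n ℝ => A + B * -(Bᵀ * Z) := by fun_prop
    have h1 := eigReIn_Iic_of_tendsto ((hcont.tendsto Y).comp hY) fun k => (F (k + 1)).2
    rwa [Matrix.mul_neg, ← Matrix.mul_assoc, ← sub_eq_add_neg] at h1

/-- The least solution, obtained from the greatest one by reversing time. -/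
theorem exists_minimal_solution {A : Matrix n n ℝ} {B : Matrix n m ℝ} {Q : Matrix n n ℝ}
    (hQ : Q.IsSymm) (hAB : Controllable A B) (hne : (ariSet A B Q).Nonempty) :
    ∃ K ∈ areSet A B Q, ∀ X ∈ ariSet A B Q, (X - K).PosSemidef := by
  have hric : ∀ K, riccati (-A) B Q (-K) = riccati A B Q K := by
    intro K
    simp [riccati]
  have hmem : ∀ K ∈ ariSet A B Q, -K ∈ ariSet (-A) B Q := fun K hK =>
    ⟨hK.1.neg, by rw [hric]; exact hK.2⟩
  have hctr : Controllable (-A) B := by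
    intro x hx
    refine hAB x fun k => ?_
    have := hx k
    rw [transpose_neg, neg_pow, ← mulVec_mulVec, mulVec_mulVec] at this
    rcases neg_one_pow_eq_or (Matrix n n ℝ) k with h | h
    · simpa [h] using this
    · simpa [h, mulVec_neg, neg_mulVec] using this
  obtain ⟨X, hX⟩ := hne
  obtain ⟨K, hK, hmax, -⟩ := exists_maximal_solution hQ hctr ⟨-X, hmem X hX⟩
  refine ⟨-K, ⟨hK.1.neg, ?_⟩, fun X hX => ?_⟩
  · rw [← hric, neg_neg]; exact hK.2
  · have := hmax _ (hmem X hX)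
    rwa [sub_neg_eq_add, add_comm, ← sub_neg_eq_add] at this

/-! ### Spectral factors, invariant subspaces and splittings -/

theorem spectralFactor_ne_zero (S : Set ℝ) (A : Matrix n n ℝ) : spectralFactor S A ≠ 0 := by
  classical
  intro h
  rw [spectralFactor, Multiset.prod_eq_zero_iff] at h
  exact UniqueFactorizationMonoid.zero_notMem_normalizedFactors _ (Multiset.mem_of_mem_filter h)

theorem re_mem_of_aeval_spectralFactor {S : Set ℝ} {A : Matrix n n ℝ} {z : ℂ}
    (h : aeval z (spectralFactor S A) = 0) : z.re ∈ S := by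
  classical
  rw [spectralFactor, map_multiset_prod, Multiset.prod_eq_zero_iff, Multiset.mem_map] at h
  obtain ⟨f, hf, hz⟩ := h
  exact Multiset.of_mem_filter hf z hz

theorem mulVec_aeval_eq_sum (A : Matrix n n ℝ) (q : ℝ[X]) {N : ℕ} (hN : q.natDegree < N)
    (x : n → ℝ) :
    aeval A q *ᵥ x = ∑ i ∈ Finset.range N, q.coeff i • (A ^ i *ᵥ x) := by
  rw [aeval_eq_sum_range' hN, sum_mulVec]
  simp only [smul_mulVec]

/-- Cayley–Hamilton: the first `n` iterates of `A` decide on all of them. -/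
theorem pow_mulVec_mem {A : Matrix n n ℝ} {V : Submodule ℝ (n → ℝ)} {x : n → ℝ}
    (h : ∀ i < Fintype.card n, A ^ i *ᵥ x ∈ V) (k : ℕ) : A ^ k *ᵥ x ∈ V := by
  rcases isEmpty_or_nonempty n with hn | hn
  · rw [Subsingleton.elim (A ^ k *ᵥ x) 0]; exact V.zero_mem
  · have hdeg : (X ^ k %ₘ A.charpoly).natDegree < Fintype.card n := by
      have := natDegree_modByMonic_lt (X ^ k) (charpoly_monic A) (by
        intro h1
        have := charpoly_natDegree_eq_dim A
        rw [h1, natDegree_one] at this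
        exact Fintype.card_ne_zero this.symm)
      rwa [charpoly_natDegree_eq_dim] at this
    rw [pow_eq_aeval_mod_charpoly, mulVec_aeval_eq_sum A _ hdeg]
    exact V.sum_mem fun i hi => V.smul_mem _ (h i (Finset.mem_range.1 hi))

theorem mem_unobservableSubspace {V : Submodule ℝ (n → ℝ)} {A : Matrix n n ℝ} {x : n → ℝ} :
    x ∈ unobservableSubspace V A ↔ ∀ k : ℕ, A ^ k *ᵥ x ∈ V := by
  simp only [unobservableSubspace, Submodule.mem_iInf, Submodule.mem_comap, mulVecLin_apply]
  exact ⟨fun h k => pow_mulVec_mem (fun i hi => h ⟨i, hi⟩) k, fun h i => h i⟩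

theorem mulVec_mem_unobservableSubspace {V : Submodule ℝ (n → ℝ)} {A : Matrix n n ℝ} {x : n → ℝ}
    (h : x ∈ unobservableSubspace V A) : A *ᵥ x ∈ unobservableSubspace V A := by
  rw [mem_unobservableSubspace] at h ⊢
  intro k
  have := h (k + 1)
  rwa [pow_succ, ← mulVec_mulVec] at this

theorem aeval_mulVec_comm (A : Matrix n n ℝ) (q : ℝ[X]) (x : n → ℝ) :
    aeval A q *ᵥ (A *ᵥ x) = A *ᵥ (aeval A q *ᵥ x) := by
  have h := congrArg (aeval A) (mul_comm q X)
  rw [map_mul, map_mul, aeval_X] at h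
  rw [mulVec_mulVec, mulVec_mulVec, h]

theorem mulVec_mem_controllableSubspace (A : Matrix n n ℝ) (B : Matrix n m ℝ) (k : ℕ)
    (u : m → ℝ) : A ^ k *ᵥ (B *ᵥ u) ∈ controllableSubspace A B := by
  refine pow_mulVec_mem (fun i hi => ?_) k
  exact Submodule.mem_iSup_of_mem (⟨i, hi⟩ : Fin (Fintype.card n)) ⟨B *ᵥ u, ⟨u, rfl⟩, rfl⟩

theorem controllableSubspace_le {A : Matrix n n ℝ} {B : Matrix n m ℝ} {V : Submodule ℝ (n → ℝ)}
    (h : ∀ (k : ℕ) (u : m → ℝ), A ^ k *ᵥ (B *ᵥ u) ∈ V) : controllableSubspace A B ≤ V := by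
  refine iSup_le fun i => ?_
  rintro _ ⟨_, ⟨u, rfl⟩, rfl⟩
  exact h i u

theorem mulVec_mem_of_mem_controllableSubspace {A : Matrix n n ℝ} {B : Matrix n m ℝ} {x : n → ℝ}
    (hx : x ∈ controllableSubspace A B) : A *ᵥ x ∈ controllableSubspace A B := by
  have : controllableSubspace A B ≤ (controllableSubspace A B).comap A.mulVecLin := by
    refine controllableSubspace_le fun k u => ?_
    rw [Submodule.mem_comap, mulVecLin_apply, mulVec_mulVec, ← pow_succ']
    exact mulVec_mem_controllableSubspace A B (k + 1) u
  exact this hx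

/-- Two matrices that agree on a common invariant subspace have the same polynomials there. -/
theorem aeval_mulVec_congr {M N : Matrix n n ℝ} {U : Submodule ℝ (n → ℝ)}
    (hU : ∀ x ∈ U, M *ᵥ x ∈ U) (hMN : ∀ x ∈ U, N *ᵥ x = M *ᵥ x) (q : ℝ[X]) {x : n → ℝ}
    (hx : x ∈ U) : aeval N q *ᵥ x = aeval M q *ᵥ x ∧ aeval M q *ᵥ x ∈ U := by
  have hpow : ∀ k : ℕ, N ^ k *ᵥ x = M ^ k *ᵥ x ∧ M ^ k *ᵥ x ∈ U := by
    intro k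
    induction k with
    | zero => simpa using hx
    | succ k ih =>
      rw [pow_succ', pow_succ', ← mulVec_mulVec, ← mulVec_mulVec, ih.1]
      exact ⟨hMN _ ih.2, hU _ ih.2⟩
  rw [mulVec_aeval_eq_sum N q (Nat.lt_succ_self _), mulVec_aeval_eq_sum M q (Nat.lt_succ_self _)]
  exact ⟨Finset.sum_congr rfl fun i _ => by rw [(hpow i).1],
    U.sum_mem fun i _ => U.smul_mem _ (hpow i).2⟩

theorem eq_zero_of_isCoprime {M : Matrix n n ℝ} {p q : ℝ[X]} (hpq : IsCoprime p q) {x : n → ℝ}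
    (hp : aeval M p *ᵥ x = 0) (hq : aeval M q *ᵥ x = 0) : x = 0 := by
  obtain ⟨r, s, h⟩ := hpq
  have := congrArg (fun f => aeval M f *ᵥ x) h
  simp only [map_add, map_mul, map_one, add_mulVec, ← mulVec_mulVec, hp, hq, mulVec_zero, add_zero,
    one_mulVec] at this
  exact this.symm

/-- A positive semidefinite form that is definite on `V` splits off `V`. -/
theorem isCompl_gapPreimage {D : Matrix n n ℝ} (hD : D.PosSemidef) {V : Submodule ℝ (n → ℝ)}
    (h : ∀ v ∈ V, D *ᵥ v = 0 → v = 0) : IsCompl V (gapPreimage D V) := by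
  have hDs := (posSemidef_real_iff.1 hD).1
  constructor
  · rw [Submodule.disjoint_def]
    intro x hx hx'
    exact h x hx (PosSemidef.mulVec_eq_zero hD (hx' x hx))
  · let b : (n → ℝ) →ₗ[ℝ] (n → ℝ) →ₗ[ℝ] ℝ := Matrix.toLinearMap₂' ℝ D
    have hb : ∀ x y, b x y = x ⬝ᵥ D *ᵥ y := fun x y => toLinearMap₂'_apply' D x y
    let f : V →ₗ[ℝ] Module.Dual ℝ V := b.domRestrict₁₂ V V
    have hf : ∀ v u : V, f v u = v.1 ⬝ᵥ D *ᵥ u.1 := fun v u => hb _ _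
    have hinj : Function.Injective f := by
      rw [← LinearMap.ker_eq_bot, LinearMap.ker_eq_bot']
      intro v hv
      have := hf v v
      rw [hv] at this
      exact Subtype.ext (h v v.2 (PosSemidef.mulVec_eq_zero hD this.symm))
    have hsurj : Function.Surjective f :=
      (LinearMap.injective_iff_surjective_of_finrank_eq_finrank
        Subspace.dual_finrank_eq.symm).1 hinj
    rw [codisjoint_iff, eq_top_iff]
    intro x _
    -- `v` is the `D`-orthogonal projection of `x` onto `V`: the forms `v ⬝ᵥ D *ᵥ u` and `x ⬝ᵥ D *ᵥ
    -- u` agree for all `u` in `V`.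
    obtain ⟨v, hv⟩ := hsurj ((b x).comp V.subtype)
    rw [← add_sub_cancel v.1 x]
    refine Submodule.add_mem_sup v.2 fun u hu => ?_
    have h1 : f v ⟨u, hu⟩ = x ⬝ᵥ D *ᵥ u := by rw [hv]; exact hb _ _
    rw [hf] at h1
    change u ⬝ᵥ D *ᵥ (x - v.1) = 0
    rw [mulVec_sub, dotProduct_sub, dotProduct_mulVec_comm hDs u x,
      dotProduct_mulVec_comm hDs u v.1, h1, sub_self]

theorem exists_isProjectionAlong {V W : Submodule ℝ (n → ℝ)} (h : IsCompl V W) :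
    ∃ P : Matrix n n ℝ, IsProjectionAlong V W P := by
  refine ⟨LinearMap.toMatrix' (V.subtype ∘ₗ Submodule.projectionOnto V W h), h, ?_, ?_⟩
  · intro x hx
    rw [← toLin'_apply, toLin'_toMatrix']
    exact congrArg Subtype.val (Submodule.projectionOnto_apply_left h ⟨x, hx⟩)
  · intro x hx
    rw [← toLin'_apply, toLin'_toMatrix']
    exact congrArg Subtype.val (Submodule.projectionOnto_apply_right h ⟨x, hx⟩)

/-- Over `ℂ` the polynomial splits, and its linear factors are cancelled one at a time under `N`.
Working modulo `ker N` covers generalized eigenvectors as well. -/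
theorem mulVec_eq_zero_of_aeval {N M : Matrix n n ℂ} {p : ℂ[X]} (hp : p ≠ 0)
    (h : ∀ a, p.IsRoot a → ∀ y, N *ᵥ ((M - a • 1) *ᵥ y) = 0 → N *ᵥ y = 0) {z : n → ℂ}
    (hz : N *ᵥ (aeval M p *ᵥ z) = 0) : N *ᵥ z = 0 := by
  have hroots : ∀ a ∈ p.roots, ∀ y, N *ᵥ ((M - a • 1) *ᵥ y) = 0 → N *ᵥ y = 0 :=
    fun a ha => h a ((mem_roots hp).1 ha)
  rw [(IsAlgClosed.splits p).eq_prod_roots, map_mul, aeval_C, ← mulVec_mulVec,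
    Algebra.algebraMap_eq_smul_one, smul_mulVec, one_mulVec, mulVec_smul] at hz
  have hz := (smul_eq_zero.1 hz).resolve_left (leadingCoeff_ne_zero.2 hp)
  clear h
  generalize p.roots = s at hroots hz
  induction s using Multiset.induction_on with
  | empty => simpa using hz
  | cons a s ih =>
    rw [Multiset.map_cons, Multiset.prod_cons, map_mul, ← mulVec_mulVec, map_sub, aeval_X, aeval_C,
      Algebra.algebraMap_eq_smul_one] at hz
    exact ih (fun b hb => hroots b (Multiset.mem_cons_of_mem hb))
      (hroots a (Multiset.mem_cons_self _ _) _ hz)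

/-! ### The gap between two solutions of the Riccati equation -/

section Gap

variable {A : Matrix n n ℝ} {B : Matrix n m ℝ} {Q Km Kp : Matrix n n ℝ}

theorem closedLoop_mulVec (A : Matrix n n ℝ) (B : Matrix n m ℝ) (K : Matrix n n ℝ) (x : n → ℝ) :
    closedLoop A B K *ᵥ x = A *ᵥ x - B *ᵥ (Bᵀ *ᵥ (K *ᵥ x)) := by
  simp only [closedLoop, sub_mulVec, ← mulVec_mulVec]

theorem closedLoop_transpose_mulVec (A : Matrix n n ℝ) (B : Matrix n m ℝ) {K : Matrix n n ℝ}
    (hK : K.IsSymm) (x : n → ℝ) :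
    (closedLoop A B K)ᵀ *ᵥ x = Aᵀ *ᵥ x - K *ᵥ (B *ᵥ (Bᵀ *ᵥ x)) := by
  simp only [closedLoop, transpose_sub, transpose_mul, transpose_transpose, sub_mulVec, hK.eq,
    ← mulVec_mulVec]

/-- The gap of two solutions of the Riccati equation intertwines their closed loops. -/
theorem gap_mulVec_closedLoop (hm : Km ∈ areSet A B Q) (hp : Kp ∈ areSet A B Q) (x : n → ℝ) :
    (Kp - Km) *ᵥ (closedLoop A B Kp *ᵥ x) = -((closedLoop A B Km)ᵀ *ᵥ ((Kp - Km) *ᵥ x)) := by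
  have hms : Kmᵀ = Km := hm.1
  have h : (closedLoop A B Km)ᵀ * (Kp - Km) + (Kp - Km) * closedLoop A B Kp = 0 := by
    have h1 : riccati A B Q Kp - riccati A B Q Km = 0 := by rw [hm.2, hp.2, sub_zero]
    rw [← h1]
    simp only [riccati, closedLoop, transpose_sub, transpose_mul, transpose_transpose, hms,
      Matrix.mul_sub, Matrix.sub_mul, Matrix.mul_assoc]
    abel
  have := congrArg (fun Y => Y *ᵥ x) h
  simp only [add_mulVec, ← mulVec_mulVec, zero_mulVec] at this
  exact eq_neg_of_add_eq_zero_right this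

theorem closedLoop_mulVec_of_gap {x : n → ℝ} (h : (Kp - Km) *ᵥ x = 0) :
    closedLoop A B Kp *ᵥ x = closedLoop A B Km *ᵥ x := by
  rw [sub_mulVec, sub_eq_zero] at h
  rw [closedLoop_mulVec, closedLoop_mulVec, h]

/-- Modulo the kernel of the gap `D`, the vector `a + ib` is an eigenvector of `A(K⁺)` for `iω`. The
identity `‖BᵀDx‖² = -2 xᵀD A(K⁺)x`, summed over `a` and `b`, cancels on the right, so `BᵀDa = BᵀDb =
0`. Then `D` intertwines with `-Aᵀ` itself, so the span of `Da` and `Db` is `Aᵀ`-invariant inside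
`ker Bᵀ`, and controllability annihilates it. -/
theorem gap_mulVec_eq_zero_of_eigen (hAB : Controllable A B) (hm : Km ∈ areSet A B Q)
    (hp : Kp ∈ areSet A B Q) {ω : ℝ} {a b : n → ℝ}
    (ha : (Kp - Km) *ᵥ (closedLoop A B Kp *ᵥ a + ω • b) = 0)
    (hb : (Kp - Km) *ᵥ (closedLoop A B Kp *ᵥ b - ω • a) = 0) :
    (Kp - Km) *ᵥ a = 0 ∧ (Kp - Km) *ᵥ b = 0 := by
  have hgap := gap_mulVec_closedLoop hm hp
  have hgap' : ∀ x, (Kp - Km) *ᵥ (closedLoop A B Km *ᵥ x) =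
      -((closedLoop A B Kp)ᵀ *ᵥ ((Kp - Km) *ᵥ x)) := by
    intro x
    have := gap_mulVec_closedLoop hp hm x
    rw [← neg_sub Kp Km, neg_mulVec, neg_mulVec, mulVec_neg, neg_inj] at this
    exact this
  have hDs : (Kp - Km).IsSymm := hp.1.sub hm.1
  have hloop : ∀ x, closedLoop A B Km *ᵥ x =
      closedLoop A B Kp *ᵥ x + B *ᵥ (Bᵀ *ᵥ ((Kp - Km) *ᵥ x)) := by
    intro x
    rw [closedLoop_mulVec, closedLoop_mulVec, sub_mulVec, mulVec_sub, mulVec_sub]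
    abel
  set D := Kp - Km with hD
  rw [mulVec_add, mulVec_smul] at ha
  rw [mulVec_sub, mulVec_smul, sub_eq_zero] at hb
  have ha := eq_neg_of_add_eq_zero_left ha
  have hnorm : ∀ x, (Bᵀ *ᵥ (D *ᵥ x)) ⬝ᵥ (Bᵀ *ᵥ (D *ᵥ x)) =
      -(2 * (x ⬝ᵥ D *ᵥ (closedLoop A B Kp *ᵥ x))) := by
    intro x
    have h1 := hgap' x
    rw [hloop, mulVec_add] at h1
    have h2 := congrArg (fun y => x ⬝ᵥ y) h1
    simp only [dotProduct_add, dotProduct_neg, dotProduct_transpose_mulVec_left] at h2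
    rw [dotProduct_mulVec_comm hDs (closedLoop A B Kp *ᵥ x) x,
      dotProduct_mulVec_comm hDs x (B *ᵥ _), ← dotProduct_transpose_mulVec_left Bᵀ,
      transpose_transpose, dotProduct_comm _ (D *ᵥ x)] at *
    have h3 : (D *ᵥ x) ⬝ᵥ B *ᵥ (Bᵀ *ᵥ (D *ᵥ x)) = (B *ᵥ (Bᵀ *ᵥ (D *ᵥ x))) ⬝ᵥ D *ᵥ x :=
      dotProduct_comm _ _
    linarith
  have hsum := congrArg₂ (· + ·) (hnorm a) (hnorm b)
  simp only [ha, hb, dotProduct_neg, dotProduct_smul, smul_eq_mul,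
    dotProduct_mulVec_comm hDs b a] at hsum
  have h1 := real_dotProduct_self_nonneg (Bᵀ *ᵥ (D *ᵥ a))
  have h2 := real_dotProduct_self_nonneg (Bᵀ *ᵥ (D *ᵥ b))
  have hBa : Bᵀ *ᵥ (D *ᵥ a) = 0 := dotProduct_self_eq_zero.1 (by linarith)
  have hBb : Bᵀ *ᵥ (D *ᵥ b) = 0 := dotProduct_self_eq_zero.1 (by linarith)
  have hAa : Aᵀ *ᵥ (D *ᵥ a) = ω • D *ᵥ b := by
    have := hgap a
    rw [closedLoop_transpose_mulVec A B hm.1, hBa, ha, mulVec_zero, mulVec_zero, sub_zero,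
      neg_inj] at this
    exact this.symm
  have hAb : Aᵀ *ᵥ (D *ᵥ b) = -(ω • D *ᵥ a) := by
    have := hgap b
    rw [closedLoop_transpose_mulVec A B hm.1, hBb, hb, mulVec_zero, mulVec_zero, sub_zero] at this
    rw [this, neg_neg]
  have hk : ∀ k : ℕ, Bᵀ *ᵥ (Aᵀ ^ k *ᵥ (D *ᵥ a)) = 0 ∧ Bᵀ *ᵥ (Aᵀ ^ k *ᵥ (D *ᵥ b)) = 0 := by
    intro k
    induction k with
    | zero => rw [pow_zero, one_mulVec, one_mulVec]; exact ⟨hBa, hBb⟩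
    | succ k ih =>
      rw [pow_succ, ← mulVec_mulVec, ← mulVec_mulVec, hAa, hAb]
      simp only [mulVec_smul, mulVec_neg, ih.1, ih.2, smul_zero, neg_zero, and_self]
  exact ⟨hAB _ fun k => (hk k).1, hAB _ fun k => (hk k).2⟩

/-- The spectral subspace of `A(K⁺)` for the imaginary axis lies in the kernel of the gap. -/
theorem gap_mulVec_eq_zero_of_aeval (hAB : Controllable A B) (hm : Km ∈ areSet A B Q)
    (hp : Kp ∈ areSet A B Q) {q : ℝ[X]} (hq : q ≠ 0) (hroots : ∀ z : ℂ, aeval z q = 0 → z.re = 0)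
    {x : n → ℝ} (hx : aeval (closedLoop A B Kp) q *ᵥ x = 0) : (Kp - Km) *ᵥ x = 0 := by
  set M := closedLoop A B Kp with hM
  set D := Kp - Km with hD
  have hmap : (aeval M q).map (algebraMap ℝ ℂ) =
      aeval (M.map (algebraMap ℝ ℂ)) (q.map (algebraMap ℝ ℂ)) :=
    map_aeval_eq_aeval_map (ψ := RingHom.mapMatrix (algebraMap ℝ ℂ)) (by
      ext r i j
      simp [algebraMap_matrix_apply]
      split_ifs <;> simp) q M
  have h0 : (q.map (algebraMap ℝ ℂ)) ≠ 0 := (Polynomial.map_ne_zero_iff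
    (algebraMap ℝ ℂ).injective).2 hq
  have hreal : ∀ (Y : Matrix n n ℝ) (y : n → ℝ),
      Y.map (algebraMap ℝ ℂ) *ᵥ (fun i => (y i : ℂ)) = fun i => ((Y *ᵥ y) i : ℂ) := by
    intro Y y
    rw [mulVec_complex]
    funext i
    apply Complex.ext <;> simp [mulVec, dotProduct]
  have key := mulVec_eq_zero_of_aeval (N := D.map (algebraMap ℝ ℂ)) (M := M.map (algebraMap ℝ ℂ))
    (z := fun i => (x i : ℂ)) h0 ?_ ?_
  · rw [hreal] at key
    funext i
    have := congrFun key i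
    simpa using this
  · intro z hz y hy
    have hre : z.re = 0 := hroots z (by rwa [IsRoot, eval_map, ← aeval_def] at hz)
    set u : n → ℝ := fun i => (y i).re with hu
    set v : n → ℝ := fun i => (y i).im with hv
    have hvec : (M.map (algebraMap ℝ ℂ) - z • 1) *ᵥ y =
        fun i => (⟨(M *ᵥ u + z.im • v) i, (M *ᵥ v - z.im • u) i⟩ : ℂ) := by
      rw [sub_mulVec, smul_mulVec, one_mulVec, mulVec_complex]
      funext i
      apply Complex.ext <;> simp [hre, hu, hv]
    rw [hvec, mulVec_complex] at hy
    have h1 : D *ᵥ (M *ᵥ u + z.im • v) = 0 :=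
      funext fun i => congrArg Complex.re (congrFun hy i)
    have h2 : D *ᵥ (M *ᵥ v - z.im • u) = 0 :=
      funext fun i => congrArg Complex.im (congrFun hy i)
    obtain ⟨h3, h4⟩ := gap_mulVec_eq_zero_of_eigen hAB hm hp h1 h2
    rw [mulVec_complex]
    funext i
    exact Complex.ext (congrFun h3 i) (congrFun h4 i)
  · rw [← hmap, hreal, hx, hreal]
    funext i
    simp

end Gap

end RiccatiTheory

/-! ### The closed loop of the solution supported by `N` -/

section Support

variable {n m : Type*} [Fintype n] [DecidableEq n] [Fintype m]
variable {A : Matrix n n ℝ} {B : Matrix n m ℝ} {Q Km Kp P : Matrix n n ℝ}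
  {L : Submodule ℝ (n → ℝ)}

theorem mulVec_mem_subspaceN {x : n → ℝ} (hx : x ∈ subspaceN A B Km L) :
    closedLoop A B Km *ᵥ x ∈ subspaceN A B Km L := by
  refine ⟨mulVec_mem_unobservableSubspace hx.1, ?_⟩
  have h : aeval (closedLoop A B Km) (spectralFactor (Set.Ioi 0) (closedLoop A B Km)) *ᵥ x = 0 :=
    hx.2
  change aeval (closedLoop A B Km) (spectralFactor (Set.Ioi 0) (closedLoop A B Km)) *ᵥ
    (closedLoop A B Km *ᵥ x) = 0
  rw [aeval_mulVec_comm, h, mulVec_zero]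

theorem mulVec_eq_zero_of_mem_subspaceN {x : n → ℝ} (hx : x ∈ subspaceN A B Km L) :
    Km *ᵥ x = 0 := by
  have := (mem_unobservableSubspace.1 hx.1 0).2
  simpa using this

/-- A polynomial with roots in the open right half plane only is injective at a matrix with
spectrum in the closed left half plane. -/
theorem eq_zero_of_aeval_spectralFactor_Ioi {M N : Matrix n n ℝ} (hM : EigReIn (Set.Iic 0) M)
    {x : n → ℝ} (hx : aeval M (spectralFactor (Set.Ioi 0) N) *ᵥ x = 0) : x = 0 := by
  refine eq_zero_of_isCoprime (M := M) (q := M.charpoly) ?_ hx ?_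
  · rw [isCoprime_iff_aeval_ne_zero_of_isAlgClosed ℝ ℂ]
    intro z
    by_contra! h
    have h1 : 0 < z.re := re_mem_of_aeval_spectralFactor h.1
    have h2 : z.re ≤ 0 := (eigReIn_iff_charpoly _ _).1 hM z h.2
    linarith
  · rw [aeval_self_charpoly, zero_mulVec]

theorem isCoprime_spectralFactor (M N : Matrix n n ℝ) :
    IsCoprime (spectralFactor {0} M) (spectralFactor (Set.Ioi 0) N) := by
  rw [isCoprime_iff_aeval_ne_zero_of_isAlgClosed ℝ ℂ]
  intro z
  by_contra! h
  have h1 : z.re = 0 := re_mem_of_aeval_spectralFactor h.1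
  have h2 : 0 < z.re := re_mem_of_aeval_spectralFactor h.2
  linarith

/-- On the kernel of the gap, which is invariant, the two closed loops coincide. There `x` is killed
by a polynomial of `A(K⁺)` with roots in the open right half plane, where `A(K⁺)` has no spectrum.
This is the definiteness needed to split off `N`. -/
theorem eq_zero_of_mem_subspaceN_of_gap (hm : Km ∈ areSet A B Q) (hp : Kp ∈ areSet A B Q)
    (hspec : EigReIn (Set.Iic 0) (closedLoop A B Kp)) {x : n → ℝ}
    (hx : x ∈ subspaceN A B Km L) (h : (Kp - Km) *ᵥ x = 0) : x = 0 := by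
  have hinv : ∀ y ∈ LinearMap.ker (Kp - Km).mulVecLin,
      closedLoop A B Kp *ᵥ y ∈ LinearMap.ker (Kp - Km).mulVecLin := by
    intro y hy
    have hy : (Kp - Km) *ᵥ y = 0 := hy
    change (Kp - Km) *ᵥ _ = 0
    rw [gap_mulVec_closedLoop hm hp, hy, mulVec_zero, neg_zero]
  have hagree : ∀ y ∈ LinearMap.ker (Kp - Km).mulVecLin,
      closedLoop A B Km *ᵥ y = closedLoop A B Kp *ᵥ y :=
    fun y hy => (closedLoop_mulVec_of_gap hy).symm
  refine eq_zero_of_aeval_spectralFactor_Ioi (N := closedLoop A B Km) hspec ?_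
  rw [← (aeval_mulVec_congr hinv hagree _ (x := x) h).1]
  exact hx.2

/-- Invariance and spectra of the closed loop that belongs to the solution supported by `N`. -/
theorem spec_supported (hAB : Controllable A B) (hm : Km ∈ areSet A B Q) (hp : Kp ∈ areSet A B Q)
    (hspec : EigReIn (Set.Iic 0) (closedLoop A B Kp))
    (hP : IsProjectionAlong (subspaceN A B Km L) (gapPreimage (Kp - Km) (subspaceN A B Km L)) P) :
    (∀ x ∈ specPos (closedLoop A B (Km * P + Kp * (1 - P))), x ∈ subspaceN A B Km L) ∧
    ∀ x ∈ specZero (closedLoop A B (Km * P + Kp * (1 - P))), (Kp - Km) *ᵥ x = 0 := by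
  obtain ⟨hcompl, hPV, hPW⟩ := hP
  set V := subspaceN A B Km L with hV
  set W := gapPreimage (Kp - Km) V with hW
  set Kb := Km * P + Kp * (1 - P) with hKb
  have hKbx : ∀ x, Kb *ᵥ x = Km *ᵥ (P *ᵥ x) + Kp *ᵥ (x - P *ᵥ x) := by
    intro x
    rw [hKb, add_mulVec, ← mulVec_mulVec, ← mulVec_mulVec, sub_mulVec, one_mulVec]
  have hVagree : ∀ x ∈ V, closedLoop A B Kb *ᵥ x = closedLoop A B Km *ᵥ x := by
    intro x hx
    rw [closedLoop_mulVec, closedLoop_mulVec, hKbx, hPV x hx, sub_self, mulVec_zero, add_zero]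
  have hWagree : ∀ x ∈ W, closedLoop A B Kb *ᵥ x = closedLoop A B Kp *ᵥ x := by
    intro x hx
    rw [closedLoop_mulVec, closedLoop_mulVec, hKbx, hPW x hx, sub_zero, mulVec_zero, zero_add]
  have hVinv : ∀ x ∈ V, closedLoop A B Km *ᵥ x ∈ V := fun x hx => mulVec_mem_subspaceN hx
  -- The intertwining relation makes invariance of `V` under `A(K⁻)` dual to invariance of `W` under
  -- `A(K⁺)`.
  have hWinv : ∀ x ∈ W, closedLoop A B Kp *ᵥ x ∈ W := by
    intro x hx v hv
    change v ⬝ᵥ (Kp - Km) *ᵥ _ = 0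
    rw [gap_mulVec_closedLoop hm hp, dotProduct_neg, dotProduct_transpose_mulVec_left,
      show _ ⬝ᵥ (Kp - Km) *ᵥ x = 0 from hx _ (hVinv v hv), neg_zero]
  have hsplit : ∀ (q : ℝ[X]) x, aeval (closedLoop A B Kb) q *ᵥ x = 0 → ∃ v ∈ V, ∃ w ∈ W,
      x = v + w ∧ aeval (closedLoop A B Km) q *ᵥ v = 0 ∧ aeval (closedLoop A B Kp) q *ᵥ w = 0 := by
    intro q x hx
    obtain ⟨v, hv, w, hw, rfl⟩ := Submodule.mem_sup.1 (hcompl.sup_eq_top ▸ Submodule.mem_top (x := x))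
    obtain ⟨h1, h2⟩ := aeval_mulVec_congr hVinv hVagree q hv
    obtain ⟨h3, h4⟩ := aeval_mulVec_congr hWinv hWagree q hw
    rw [mulVec_add, h1, h3] at hx
    have h5 := eq_neg_of_add_eq_zero_left hx
    have h6 := Submodule.disjoint_def.1 hcompl.disjoint _ h2 (h5 ▸ W.neg_mem h4)
    rw [h6, zero_add] at hx
    exact ⟨v, hv, w, hw, rfl, h6, hx⟩
  constructor
  · intro x hx
    obtain ⟨v, hv, w, hw, rfl, -, h2⟩ := hsplit _ x hx
    rw [eq_zero_of_aeval_spectralFactor_Ioi hspec h2, add_zero]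
    exact hv
  · intro x hx
    obtain ⟨v, hv, w, hw, rfl, h1, h2⟩ := hsplit _ x hx
    -- The `V`-component is killed by a factor with imaginary roots and, as a member of `N`, by one
    -- with roots in the open right half plane. Only the `W`-component survives, and there the
    -- closed loop is `A(K⁺)`.
    rw [eq_zero_of_isCoprime (isCoprime_spectralFactor _ _) h1 hv.2, zero_add]
    exact gap_mulVec_eq_zero_of_aeval hAB hm hp (spectralFactor_ne_zero _ _)
      (fun z hz => re_mem_of_aeval_spectralFactor hz) h2

theorem areSet_subset_ariSet (A : Matrix n n ℝ) (B : Matrix n m ℝ) (Q : Matrix n n ℝ) :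
    areSet A B Q ⊆ ariSet A B Q :=
  fun _ hK => ⟨hK.1, hK.2 ▸ .zero⟩

end Support

/-! ### Change of coordinates and restriction to the controllable subspace -/

section Coordinates

variable {n m p q : Type*} [Fintype n] [DecidableEq n] [Fintype m] [Fintype p] [DecidableEq p]
  [Fintype q] [DecidableEq q]

theorem riccati_congruence {l : Type*} [Fintype l] [DecidableEq l]
    (A : Matrix n n ℝ) (B : Matrix n m ℝ) (Q K : Matrix n n ℝ) {T : Matrix n l ℝ}
    {Tinv : Matrix l n ℝ} (hT : T * Tinv = 1) :
    Tᵀ * riccati A B Q K * T =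
      riccati (Tinv * A * T) (Tinv * B) (Tᵀ * Q * T) (Tᵀ * K * T) := by
  have h1 : ∀ Y : Matrix n l ℝ, T * (Tinv * Y) = Y := by
    intro Y
    rw [← Matrix.mul_assoc, hT, Matrix.one_mul]
  have h2 : ∀ Y : Matrix n l ℝ, Tinvᵀ * (Tᵀ * Y) = Y := by
    intro Y
    rw [← Matrix.mul_assoc, ← transpose_mul, hT, transpose_one, Matrix.one_mul]
  simp only [riccati, transpose_mul, Matrix.mul_assoc, Matrix.mul_add, Matrix.mul_sub,
    Matrix.add_mul, Matrix.sub_mul, h1, h2]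

/-- With `A` block upper triangular and `BBᵀ` supported in its first block, no other block of `K`
enters the upper left corner of `φ(K)`. -/
theorem riccati_toBlocks₁₁ {A : Matrix (p ⊕ q) (p ⊕ q) ℝ} {B : Matrix (p ⊕ q) m ℝ}
    (Q K : Matrix (p ⊕ q) (p ⊕ q) ℝ) (hA : A.toBlocks₂₁ = 0) (hB : B.toRows₂ = 0) :
    (riccati A B Q K).toBlocks₁₁ =
      riccati A.toBlocks₁₁ B.toRows₁ Q.toBlocks₁₁ K.toBlocks₁₁ := by
  have h : riccati A B Q K = Aᵀ * K + K * A + Q - K * (B * Bᵀ) * K := by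
    rw [riccati, Matrix.mul_assoc K B]
  rw [h, riccati]
  conv_lhs => rw [← fromBlocks_toBlocks A, ← fromBlocks_toBlocks K, ← fromBlocks_toBlocks Q,
    ← fromRows_toRows B]
  rw [hA, hB, transpose_fromRows, fromRows_mul_fromCols, fromBlocks_transpose, fromBlocks_multiply,
    fromBlocks_multiply, fromBlocks_multiply, fromBlocks_multiply, fromBlocks_add, fromBlocks_add,
    sub_eq_add_neg, fromBlocks_neg, fromBlocks_add, toBlocks_fromBlocks₁₁]
  simp [Matrix.mul_assoc, sub_eq_add_neg]

variable {A : Matrix n n ℝ} {B : Matrix n m ℝ} {T : Matrix n (p ⊕ q) ℝ}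
  {Tinv : Matrix (p ⊕ q) n ℝ}

theorem toRows₂_mul_toCols₁ (hT' : Tinv * T = 1) : Tinv.toRows₂ * T.toCols₁ = 0 := by
  ext i j
  have := congrFun (congrFun hT' (Sum.inr i)) (Sum.inl j)
  rw [one_apply_ne (by simp)] at this
  exact this

theorem toRows₁_mul_toCols₁ (hT' : Tinv * T = 1) : Tinv.toRows₁ * T.toCols₁ = 1 := by
  ext i j
  have := congrFun (congrFun hT' (Sum.inl i)) (Sum.inl j)
  simp only [one_apply, Sum.inl.injEq] at this ⊢
  exact this

theorem toRows₂_mulVec_eq_zero (hT' : Tinv * T = 1)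
    (hC : controllableSubspace A B = LinearMap.range T.toCols₁.mulVecLin) {x : n → ℝ}
    (hx : x ∈ controllableSubspace A B) : Tinv.toRows₂ *ᵥ x = 0 := by
  rw [hC] at hx
  obtain ⟨u, rfl⟩ := hx
  rw [mulVecLin_apply, mulVec_mulVec, toRows₂_mul_toCols₁ hT', zero_mulVec]

theorem toBlocks₂₁_eq_zero (hT' : Tinv * T = 1)
    (hC : controllableSubspace A B = LinearMap.range T.toCols₁.mulVecLin) :
    (Tinv * A * T).toBlocks₂₁ = 0 := by
  have h : (Tinv * A * T).toBlocks₂₁ = Tinv.toRows₂ * (A * T.toCols₁) := by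
    rw [Matrix.mul_assoc]
    rfl
  rw [h]
  refine ext_of_mulVec_single fun j => ?_
  rw [← mulVec_mulVec, ← mulVec_mulVec, zero_mulVec]
  refine toRows₂_mulVec_eq_zero hT' hC (mulVec_mem_of_mem_controllableSubspace ?_)
  rw [hC]
  exact ⟨_, rfl⟩

theorem toRows₂_mul_eq_zero (hT' : Tinv * T = 1)
    (hC : controllableSubspace A B = LinearMap.range T.toCols₁.mulVecLin) :
    (Tinv * B).toRows₂ = 0 := by
  classical
  have h : (Tinv * B).toRows₂ = Tinv.toRows₂ * B := rfl
  rw [h]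
  refine ext_of_mulVec_single fun j => ?_
  rw [← mulVec_mulVec, zero_mulVec]
  refine toRows₂_mulVec_eq_zero hT' hC ?_
  simpa using mulVec_mem_controllableSubspace A B 0 (Pi.single j 1)

/-- The restriction of a system to its controllable subspace is controllable. -/
theorem controllable_restriction (hT' : Tinv * T = 1)
    (hC : controllableSubspace A B = LinearMap.range T.toCols₁.mulVecLin) :
    Controllable (Tinv * A * T).toBlocks₁₁ (Tinv * B).toRows₁ := by
  set A₁ := (Tinv * A * T).toBlocks₁₁ with hA₁
  set B₁ := (Tinv * B).toRows₁ with hB₁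
  have hstep : ∀ x ∈ controllableSubspace A B,
      Tinv.toRows₁ *ᵥ (A *ᵥ x) = A₁ *ᵥ (Tinv.toRows₁ *ᵥ x) := by
    intro x hx
    have h1 : A₁ = Tinv.toRows₁ * (A * T.toCols₁) := by
      rw [hA₁, Matrix.mul_assoc]
      rfl
    rw [hC] at hx
    obtain ⟨u, rfl⟩ := hx
    simp only [mulVecLin_apply, mulVec_mulVec, toRows₁_mul_toCols₁ hT', Matrix.mul_one, h1]
  have hpow : ∀ (k : ℕ) (u : m → ℝ),
      Tinv.toRows₁ *ᵥ (A ^ k *ᵥ (B *ᵥ u)) = A₁ ^ k *ᵥ (B₁ *ᵥ u) := by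
    intro k u
    induction k with
    | zero =>
      rw [pow_zero, pow_zero, one_mulVec, one_mulVec, mulVec_mulVec]
      rfl
    | succ k ih =>
      rw [pow_succ', pow_succ', ← mulVec_mulVec, ← mulVec_mulVec,
        hstep _ (mulVec_mem_controllableSubspace A B k u), ih]
  intro x hx
  -- A vector `x` annihilating all `A₁ᵏB₁` is orthogonal to the coordinates of every controllable
  -- vector. The vector with coordinates `x` is itself controllable, so `x ⬝ᵥ x = 0`.
  have hle : controllableSubspace A B ≤
      (orthComplement (Submodule.span ℝ {x})).comap Tinv.toRows₁.mulVecLin := by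
    refine controllableSubspace_le fun k u v hv => ?_
    obtain ⟨c, rfl⟩ := Submodule.mem_span_singleton.1 hv
    rw [mulVecLin_apply, hpow, smul_dotProduct, dotProduct_comm]
    have h1 := dotProduct_transpose_mulVec_left B₁ u (A₁ᵀ ^ k *ᵥ x)
    rw [hx k, dotProduct_zero, ← transpose_pow, dotProduct_transpose_mulVec_left] at h1
    rw [← h1, smul_zero]
  have h2 : T.toCols₁ *ᵥ x ∈ controllableSubspace A B := by
    rw [hC]
    exact ⟨x, rfl⟩
  have h3 := hle h2 x (Submodule.mem_span_singleton_self x)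
  rw [mulVecLin_apply, mulVec_mulVec, toRows₁_mul_toCols₁ hT', one_mulVec] at h3
  exact dotProduct_self_eq_zero.1 h3

theorem toBlocks₁₁_mem_ariSet {Q K : Matrix n n ℝ} (hT : T * Tinv = 1) (hT' : Tinv * T = 1)
    (hC : controllableSubspace A B = LinearMap.range T.toCols₁.mulVecLin)
    (hK : K ∈ ariSet A B Q) :
    (Tᵀ * K * T).toBlocks₁₁ ∈
      ariSet (Tinv * A * T).toBlocks₁₁ (Tinv * B).toRows₁ (Tᵀ * Q * T).toBlocks₁₁ := by
  constructor
  · have h : (Tᵀ * K * T).IsSymm := by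
      rw [IsSymm, transpose_mul, transpose_mul, transpose_transpose, hK.1.eq, Matrix.mul_assoc]
    exact h.submatrix Sum.inl
  · rw [← riccati_toBlocks₁₁ _ _ (toBlocks₂₁_eq_zero hT' hC) (toRows₂_mul_eq_zero hT' hC),
      ← riccati_congruence A B Q K hT]
    have := hK.2.conjTranspose_mul_mul_same T
    rw [conjTranspose_eq_transpose_of_trivial] at this
    exact this.submatrix Sum.inl

theorem PosSemidef.apply_self_nonneg {X : Matrix n n ℝ} (hX : X.PosSemidef) (j : n) :
    0 ≤ X j j := by
  have := (posSemidef_real_iff.1 hX).2 (Pi.single j 1)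
  simpa using this

theorem PosSemidef.apply_eq_zero {X : Matrix n n ℝ} (hX : X.PosSemidef) {j : n}
    (h : X j j = 0) (i : n) : X i j = 0 := by
  have := PosSemidef.mulVec_eq_zero hX (x := Pi.single j 1) (by simpa using h)
  simpa using congrFun this i

end Coordinates

end LQ

/-! ### The block form -/

theorem lemma4p3 {n m n₁₁ n₁₂ n₁₃ n₂ : ℕ}
    (A : Matrix (Fin n) (Fin n) ℝ) (B : Matrix (Fin n) (Fin m) ℝ) (Q : Matrix (Fin n) (Fin n) ℝ)
    (hQ : Q.IsSymm) (L : Submodule ℝ (Fin n → ℝ))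
    -- the standing assumption
    (hstab : Stabilizable A B) (hΓ : (ariNegSet A B Q).Nonempty)
    -- an invertible change of coordinates whose first group of columns spans the controllable
    -- subspace, and whose last group spans an arbitrary complement of it
    (T : Matrix (Fin n) ((Fin n₁₁ ⊕ (Fin n₁₂ ⊕ Fin n₁₃)) ⊕ Fin n₂) ℝ)
    (Tinv : Matrix ((Fin n₁₁ ⊕ (Fin n₁₂ ⊕ Fin n₁₃)) ⊕ Fin n₂) (Fin n) ℝ)
    (hT : T * Tinv = 1) (hT' : Tinv * T = 1)
    (hC : controllableSubspace A B = LinearMap.range T.toCols₁.mulVecLin)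
    -- the controllable subsystem and the terminal subspace, in the new coordinates
    (A₁ : Matrix (Fin n₁₁ ⊕ (Fin n₁₂ ⊕ Fin n₁₃)) (Fin n₁₁ ⊕ (Fin n₁₂ ⊕ Fin n₁₃)) ℝ)
    (hA₁ : A₁ = (Tinv * A * T).toBlocks₁₁)
    (B₁ : Matrix (Fin n₁₁ ⊕ (Fin n₁₂ ⊕ Fin n₁₃)) (Fin m) ℝ)
    (hB₁ : B₁ = (Tinv * B).toRows₁)
    (Q₁ : Matrix (Fin n₁₁ ⊕ (Fin n₁₂ ⊕ Fin n₁₃)) (Fin n₁₁ ⊕ (Fin n₁₂ ⊕ Fin n₁₃)) ℝ)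
    (hQ₁ : Q₁ = (Tᵀ * Q * T).toBlocks₁₁)
    (L₁ : Submodule ℝ (Fin n₁₁ ⊕ (Fin n₁₂ ⊕ Fin n₁₃) → ℝ))
    (hL₁ : L₁ = L.comap T.toCols₁.mulVecLin) :
    -- the extremal solutions of the Riccati equation of the subsystem, and the projection onto
    -- `N₁(L₁)` along `Δ₁⁻¹(N₁(L₁)^⊥)`; the three are determined by these properties
    ∃ Km Kp P : Matrix (Fin n₁₁ ⊕ (Fin n₁₂ ⊕ Fin n₁₃)) (Fin n₁₁ ⊕ (Fin n₁₂ ⊕ Fin n₁₃)) ℝ,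
      IsMinimalElement (areSet A₁ B₁ Q₁) Km ∧
      IsMaximalElement (areSet A₁ B₁ Q₁) Kp ∧
      IsProjectionAlong (subspaceN A₁ B₁ Km L₁)
        (gapPreimage (Kp - Km) (subspaceN A₁ B₁ Km L₁)) P ∧
      (SpectrallyAdapted (closedLoop A₁ B₁ (Km * P + Kp * (1 - P))) →
        ∀ K ∈ ariNegSet A B Q,
          ∃ (K₁₃₃ : Matrix (Fin n₁₃) (Fin n₁₃) ℝ) (K₁₂₂ : Matrix (Fin n₁₂) (Fin n₂) ℝ)
            (K₁₂₃ : Matrix (Fin n₁₃) (Fin n₂) ℝ) (K₂ : Matrix (Fin n₂) (Fin n₂) ℝ),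
            Tᵀ * K * T =
              fromBlocks
                (fromBlocks 0 0 0
                  (fromBlocks Km.toBlocks₂₂.toBlocks₁₁ Km.toBlocks₂₂.toBlocks₁₂
                    Km.toBlocks₂₂.toBlocks₁₂ᵀ K₁₃₃))
                (fromRows 0 (fromRows K₁₂₂ K₁₂₃))
                (fromCols 0 (fromCols K₁₂₂ᵀ K₁₂₃ᵀ))
                K₂) := by
  have hAB : Controllable A₁ B₁ := hA₁ ▸ hB₁ ▸ controllable_restriction hT' hC
  have hsub : ∀ K ∈ ariSet A B Q, (Tᵀ * K * T).toBlocks₁₁ ∈ ariSet A₁ B₁ Q₁ := by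
    intro K hK
    rw [hA₁, hB₁, hQ₁]
    exact toBlocks₁₁_mem_ariSet hT hT' hC hK
  have hQ₁s : Q₁.IsSymm := by
    have h : (Tᵀ * Q * T).IsSymm := by
      rw [IsSymm, transpose_mul, transpose_mul, transpose_transpose, hQ.eq, Matrix.mul_assoc]
    rw [hQ₁]
    exact h.submatrix Sum.inl
  have hne : (ariSet A₁ B₁ Q₁).Nonempty := ⟨_, hsub _ hΓ.some_mem.1⟩
  obtain ⟨Kp, hKp, hmax, hspec⟩ := exists_maximal_solution hQ₁s hAB hne
  obtain ⟨Km, hKm, hmin⟩ := exists_minimal_solution hQ₁s hAB hne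
  have hgap : (Kp - Km).PosSemidef := hmax _ (areSet_subset_ariSet _ _ _ hKm)
  obtain ⟨P, hP⟩ := exists_isProjectionAlong (isCompl_gapPreimage hgap
    (V := subspaceN A₁ B₁ Km L₁)
    fun v hv h => eq_zero_of_mem_subspaceN_of_gap hKm hKp hspec hv h)
  refine ⟨Km, Kp, P, ⟨hKm, fun N hN => hmin N (areSet_subset_ariSet _ _ _ hN)⟩,
    ⟨hKp, fun N hN => hmax N (areSet_subset_ariSet _ _ _ hN)⟩, hP, ?_⟩
  intro hadapt K hK
  obtain ⟨hpos, hzero⟩ := spec_supported hAB hKm hKp hspec hP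
  have hK₁ := hsub K hK.1
  have hneg : (-(Tᵀ * K * T)).PosSemidef := by
    have := hK.2.conjTranspose_mul_mul_same T
    rwa [conjTranspose_eq_transpose_of_trivial, Matrix.mul_neg, Matrix.neg_mul] at this
  generalize Tᵀ * K * T = K' at hK₁ hneg
  have hsymm : ∀ i j, K' i j = K' j i := by
    have h := (posSemidef_real_iff.1 hneg).1.neg
    rw [neg_neg] at h
    exact fun i j => h.apply j i
  have hcol₁ : ∀ i j, Km i (Sum.inl j) = 0 := by
    intro i j
    have h1 : (Pi.single (Sum.inl j) 1 : Fin n₁₁ ⊕ (Fin n₁₂ ⊕ Fin n₁₃) → ℝ) ∈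
        specPos (closedLoop A₁ B₁ (Km * P + Kp * (1 - P))) := by
      rw [hadapt.1]
      exact Submodule.subset_span ⟨_, ⟨j, rfl⟩, rfl⟩
    simpa using congrFun (mulVec_eq_zero_of_mem_subspaceN (hpos _ h1)) i
  -- The diagonal entry is nonnegative by minimality of `Km`, whose column vanishes, and nonpositive
  -- since `K ≤ 0`. Semidefiniteness of the full matrix then clears the column for all row indices.
  have hzero₁ : ∀ i j, K' i (Sum.inl (Sum.inl j)) = 0 := by
    intro i j
    have h1 := PosSemidef.apply_self_nonneg (hmin _ hK₁) (Sum.inl j)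
    have h2 := PosSemidef.apply_self_nonneg hneg (Sum.inl (Sum.inl j))
    rw [Matrix.sub_apply, hcol₁, sub_zero] at h1
    have h1 : 0 ≤ K' (Sum.inl (Sum.inl j)) (Sum.inl (Sum.inl j)) := h1
    rw [neg_apply] at h2
    have h3 := PosSemidef.apply_eq_zero hneg (j := Sum.inl (Sum.inl j))
      (by rw [neg_apply]; linarith) i
    rwa [neg_apply, neg_eq_zero] at h3
  -- `Km` and `Kp` share this diagonal entry, so the sandwich makes the diagonal entry of `K₁ - Km ≥
  -- 0` zero, hence its column. Only rows of the controllable part are reached, which leaves the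
  -- coupling to the complement free.
  have hcol₂ : ∀ i j, K' (Sum.inl i) (Sum.inl (Sum.inr (Sum.inl j))) =
      Km i (Sum.inr (Sum.inl j)) := by
    intro i j
    have h1 : (Pi.single (Sum.inr (Sum.inl j)) 1 : Fin n₁₁ ⊕ (Fin n₁₂ ⊕ Fin n₁₃) → ℝ) ∈
        specZero (closedLoop A₁ B₁ (Km * P + Kp * (1 - P))) := by
      rw [hadapt.2.1]
      exact Submodule.subset_span ⟨_, ⟨j, rfl⟩, rfl⟩
    have h2 := congrFun (hzero _ h1) (Sum.inr (Sum.inl j))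
    have h3 := PosSemidef.apply_self_nonneg (hmin _ hK₁) (Sum.inr (Sum.inl j))
    have h4 := PosSemidef.apply_self_nonneg (hmax _ hK₁) (Sum.inr (Sum.inl j))
    have h2 : Kp (Sum.inr (Sum.inl j)) (Sum.inr (Sum.inl j)) -
        Km (Sum.inr (Sum.inl j)) (Sum.inr (Sum.inl j)) = 0 := by simpa using h2
    rw [Matrix.sub_apply] at h3 h4
    have h5 := PosSemidef.apply_eq_zero (hmin _ hK₁) (j := Sum.inr (Sum.inl j))
      (by rw [Matrix.sub_apply]; linarith) i
    rw [Matrix.sub_apply, sub_eq_zero] at h5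
    exact h5
  have hKms : ∀ i j, Km i j = Km j i := fun i j => hKm.1.apply j i
  refine ⟨K'.toBlocks₁₁.toBlocks₂₂.toBlocks₂₂,
    of fun i j => K' (Sum.inl (Sum.inr (Sum.inl i))) (Sum.inr j),
    of fun i j => K' (Sum.inl (Sum.inr (Sum.inr i))) (Sum.inr j), K'.toBlocks₂₂, ?_⟩
  have hrow₁ : ∀ i j, K' (Sum.inl (Sum.inl j)) i = 0 := fun i j => by rw [hsymm, hzero₁]
  have hrow₂ : ∀ i j, K' (Sum.inl (Sum.inr (Sum.inl j))) (Sum.inl i) =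
      Km (Sum.inr (Sum.inl j)) i := fun i j => by rw [hsymm, hcol₂, hKms]
  ext ((i | i | i) | i) ((j | j | j) | j)
  · simp [hzero₁]
  · simp [hrow₁]
  · simp [hrow₁]
  · simp [hrow₁]
  · simp [hzero₁]
  · simp [hcol₂, toBlocks₁₁, toBlocks₂₂]
  · simp [hrow₂, toBlocks₁₂, toBlocks₂₂]
  · simp
  · simp [hzero₁]
  · simp [hcol₂, toBlocks₁₂, toBlocks₂₂, hKms (Sum.inr (Sum.inr i))]
  · simp [toBlocks₁₁, toBlocks₂₂]
  · simp
  · simp [hzero₁]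
  · simp [hsymm (Sum.inr i)]
  · simp [hsymm (Sum.inr i)]
  · simp [toBlocks₂₂]
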